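/- Let $N\ge 11$ be an integer and let $f\in C^1(\mathbb R)\cap C^2(\mathbb R\setminus\{0\})$ be odd with $f(u)>0$, $f'(u)>0$, $f''(u)>0$ and $F(u):=\int_u^\infty \frac{ds}{f(s)}<\infty$ for all $u>0$. Let $q_1,q_2$ be constants with $1\le q_1\le q_2$ and $$q_2(2N-4q_1)\le \frac{(N-2)^2}{4},$$ and suppose that $$q_1\le \frac{f'(u)^2}{f(u)f''(u)}\le q_2\qquad\text{for all } u>0.$$ Then $$q_1\le f'(u)F(u)\le q_2\qquad\text{for all } u>0.$$ If moreover $q_1\le q_{JL}:=\frac{N-2\sqrt{N-1}}{4}$, then the following structure (II) holds. For every $\alpha>0$ the problem $$u''+\frac{N-1}{r}u'+f(u)=0\quad (r>0),\qquad u(0)=\alpha,\quad u'(0)=0$$ has a unique solution $u(\cdot,\alpha)\in C^1[0,\infty)\cap C^2(0,\infty)$; the function $U_\alpha(x)=u(|x|,\alpha)$ is a stable solution of $\Delta U+f(U)=0$ in $\mathbb R^N$, that is, $U_\alpha\in C^2(\mathbb R^N)$ solves this equation and $$\int_{\mathbb R^N}\bigl(|\nabla\phi|^2-f'(U_\alpha)\phi^2\bigr)\,dx\ge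 0\qquad\text{for every } \phi\in C^1_0(\mathbb R^N)$$ (compactly supported $C^1$ functions); and $u(r,\alpha)$ is strictly increasing in $\alpha>0$ for each fixed $r>0$. -/

import Mathlib

open Set MeasureTheory
open scoped Laplacian

/-- The standing assumptions on the nonlinearity `f`: it is odd, `C¹` on `ℝ`, `C²` away from `0`,
and `f`, `f'`, `f''` are positive and `1 / f` is integrable at infinity on the positive axis. -/
structure IsAdmissible (f : ℝ → ℝ) : Prop where
  contDiff_one : ContDiff ℝ 1 f
  contDiffOn_two : ContDiffOn ℝ 2 f {0}ᶜ
  odd : ∀ u, f (-u) = -f u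
  pos : ∀ u, 0 < u → 0 < f u
  deriv_pos : ∀ u, 0 < u → 0 < deriv f u
  deriv_deriv_pos : ∀ u, 0 < u → 0 < deriv (deriv f) u
  integrableOn : ∀ u, 0 < u → IntegrableOn (fun s => 1 / f s) (Ioi u)

/-- `F(u) = ∫_u^∞ ds / f(s)`. -/
noncomputable def tailIntegral (f : ℝ → ℝ) (u : ℝ) : ℝ := ∫ s in Ioi u, 1 / f s

/-- The Hölder conjugate `q_JL = (N - 2 √(N - 1)) / 4` of the Joseph–Lundgren exponent. -/
noncomputable def qJL (N : ℕ) : ℝ := ((N : ℝ) - 2 * Real.sqrt ((N : ℝ) - 1)) / 4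

/-- `u` (only its values on `[0, ∞)` matter) is a classical solution of
`u'' + (N - 1) / r * u' + f(u) = 0` for `r > 0`, with `u(0) = α` and `u'(0) = 0`. -/
structure IsRadialSolution (N : ℕ) (f : ℝ → ℝ) (α : ℝ) (u : ℝ → ℝ) : Prop where
  contDiffOn_one : ContDiffOn ℝ 1 u (Ici 0)
  contDiffOn_two : ContDiffOn ℝ 2 u (Ioi 0)
  ode : ∀ r, 0 < r → deriv (deriv u) r + ((N : ℝ) - 1) / r * deriv u r + f (u r) = 0
  init : u 0 = α
  deriv_init : derivWithin u (Ici 0) 0 = 0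

/-- `U` is a stable solution of `Δ U + f(U) = 0` in `ℝᴺ`: it is a `C²` solution, and
`∫ (|∇φ|² - f'(U) φ²) ≥ 0` for every compactly supported `C¹` function `φ`. -/
structure IsStableSolution (N : ℕ) (f : ℝ → ℝ) (U : EuclideanSpace ℝ (Fin N) → ℝ) : Prop where
  contDiff_two : ContDiff ℝ 2 U
  equation : ∀ x, Δ U x + f (U x) = 0
  stable : ∀ φ : EuclideanSpace ℝ (Fin N) → ℝ, ContDiff ℝ 1 φ → HasCompactSupport φ →
    0 ≤ ∫ x, (‖gradient φ x‖ ^ 2 - deriv f (U x) * φ x ^ 2)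

/-- Structure (II): for every `α > 0` the radial problem has a unique solution `u(·, α)` on
`[0, ∞)`, the function `x ↦ u(|x|, α)` is a stable solution, and `u(r, α)` is strictly
increasing in `α > 0` for each fixed `r > 0`. -/
def StructureII (N : ℕ) (f : ℝ → ℝ) : Prop :=
  ∃ u : ℝ → ℝ → ℝ,
    (∀ α, 0 < α → IsRadialSolution N f α (fun r => u r α) ∧
      ∀ v, IsRadialSolution N f α v → ∀ r, 0 ≤ r → v r = u r α) ∧
    (∀ α, 0 < α → IsStableSolution N f (fun x => u ‖x‖ α)) ∧
    (∀ r, 0 < r → StrictMonoOn (fun α => u r α) (Ioi 0))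

/-! Bounds on `f' F`. The hypothesis fixes the sign of the derivative of `F - q / f'`, and both `F`
and `1 / f'` vanish at infinity, since a bounded `f'` would make `1 / f` non-integrable.

Structure (II). Along a positive radial solution, `w = F(u)` satisfies `w'' + (N-1)/r w' = 1 + f'(u)
w'²`, and `f'(u) ≥ q₁ / w`. If equality held there, `r² / b` with `b = 2N - 4q₁` would be an exact
singular solution. The function `g = log (b w / r²)` measures the deviation from it. Linearizing by
`e^{-g} ≥ 1 - g` and dropping the square of `r g'` gives `(r d/dr + l₁)(r d/dr + l₂) g ≥ 0`. The
roots `l₁`, `l₂` are real and positive exactly because `q₁ ≤ q_JL`, and two integrations from the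
origin give `g ≥ 0` (`IsAdmissible.sq_le_mul_tailIntegral`). Therefore `f'(u) r² ≤ b f'(u) F(u) ≤ b
q₂ ≤ ((N-2)/2)²`, so `f'(u)` lies below the Hardy potential.

This one bound yields the rest. Hardy's inequality (`hardy_regularized`) gives stability. By
convexity, both `u` itself and the difference of two ordered solutions are subsolutions of the Hardy
operator, which cannot reach zero (`pos_of_hardy_subsolution`); this gives global positivity and
strict monotonicity in `α`. Existence comes from a contraction for `f` truncated to values in `[0,
α]`, and uniqueness from an energy estimate. -/

open Filter Topology

/-! ### Convexity of `f` and behaviour of `F` and `f'` at infinity -/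

namespace IsAdmissible

variable {f : ℝ → ℝ}

theorem map_zero (hf : IsAdmissible f) : f 0 = 0 := by
  have := hf.odd 0
  simp only [neg_zero] at this
  linarith

theorem hasDerivAt (hf : IsAdmissible f) (u : ℝ) : HasDerivAt f (deriv f u) u :=
  (hf.contDiff_one.differentiable (by norm_num) u).hasDerivAt

theorem continuous (hf : IsAdmissible f) : Continuous f := hf.contDiff_one.continuous

theorem continuous_deriv (hf : IsAdmissible f) : Continuous (deriv f) :=
  hf.contDiff_one.continuous_deriv le_rfl

theorem hasDerivAt_deriv (hf : IsAdmissible f) {u : ℝ} (hu : 0 < u) :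
    HasDerivAt (deriv f) (deriv (deriv f) u) u := by
  have ho : IsOpen ({0}ᶜ : Set ℝ) := isOpen_compl_singleton
  have h : ContDiffOn ℝ 1 (deriv f) {0}ᶜ :=
    ((contDiffOn_succ_iff_deriv_of_isOpen (n := 1) ho).1 (by rw [one_add_one_eq_two]; exact hf.contDiffOn_two)).2.2
  exact ((h.differentiableOn (by norm_num)).differentiableAt (ho.mem_nhds hu.ne')).hasDerivAt

theorem strictMonoOn_deriv (hf : IsAdmissible f) : StrictMonoOn (deriv f) (Ici 0) := by
  refine strictMonoOn_of_deriv_pos (convex_Ici 0) hf.continuous_deriv.continuousOn ?_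
  intro x hx
  rw [interior_Ici] at hx
  exact hf.deriv_deriv_pos x hx

/-- Convexity, with the slope taken at the larger point. With `a = 0` it makes a solution a
subsolution of its linearization; for general `a` it does the same for a difference of two
solutions. -/
theorem sub_le_deriv_mul (hf : IsAdmissible f) {a b : ℝ} (ha : 0 ≤ a) (hab : a < b) :
    f b - f a ≤ deriv f b * (b - a) := by
  obtain ⟨c, hc, hc'⟩ := exists_hasDerivAt_eq_slope f (deriv f) hab hf.continuous.continuousOn
    (fun x _ => hf.hasDerivAt x)
  have h1 : deriv f c ≤ deriv f b :=
    hf.strictMonoOn_deriv.monotoneOn (ha.trans hc.1.le) (ha.trans hab.le) hc.2.le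
  rw [hc', div_le_iff₀ (sub_pos.2 hab)] at h1
  exact h1

theorem hasDerivAt_tailIntegral (hf : IsAdmissible f) {u : ℝ} (hu : 0 < u) :
    HasDerivAt (tailIntegral f) (-(1 / f u)) u := by
  have hcont : ContinuousOn (fun s => 1 / f s) (Ioi 0) :=
    continuousOn_const.div hf.continuous.continuousOn fun x hx => (hf.pos x hx).ne'
  -- The base point `u / 2` is positive and lies below every `v` near `u`, so the tail splits there.
  have h1 : HasDerivAt (fun v => ∫ s in (u / 2)..v, 1 / f s) (1 / f u) u := by
    refine intervalIntegral.integral_hasDerivAt_right ?_ ?_ (hcont.continuousAt (Ioi_mem_nhds hu))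
    · refine (hcont.mono fun x hx => ?_).intervalIntegrable
      rw [uIcc_of_le (by linarith)] at hx
      exact lt_of_lt_of_le (by linarith) hx.1
    · exact hcont.stronglyMeasurableAtFilter isOpen_Ioi u hu
  have h2 : HasDerivAt (fun v => tailIntegral f (u / 2) - ∫ s in (u / 2)..v, 1 / f s)
      (-(1 / f u)) u := h1.const_sub _
  refine h2.congr_of_eventuallyEq ?_
  filter_upwards [Ioi_mem_nhds (show u / 2 < u by linarith)] with v hv
  rw [← intervalIntegral.integral_Ioi_sub_Ioi (hf.integrableOn (u / 2) (by linarith)) (le_of_lt hv)]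
  simp [tailIntegral]

theorem tailIntegral_pos (hf : IsAdmissible f) {u : ℝ} (hu : 0 < u) : 0 < tailIntegral f u := by
  rw [tailIntegral, setIntegral_pos_iff_support_of_nonneg_ae]
  · have : Function.support (fun s => 1 / f s) ∩ Ioi u = Ioi u := by
      refine inter_eq_right.2 fun x hx => ?_
      exact (one_div_pos.2 (hf.pos x (hu.trans hx))).ne'
    rw [this]
    simp
  · refine (ae_restrict_iff' measurableSet_Ioi).2 (Eventually.of_forall fun x hx => ?_)
    exact (one_div_pos.2 (hf.pos x (hu.trans hx))).le
  · exact hf.integrableOn u hu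

theorem tendsto_tailIntegral (hf : IsAdmissible f) : Tendsto (tailIntegral f) atTop (𝓝 0) := by
  have h := intervalIntegral_tendsto_integral_Ioi 1 (hf.integrableOn 1 one_pos) tendsto_id
  have h2 : Tendsto (fun v => tailIntegral f 1 - ∫ s in (1 : ℝ)..v, 1 / f s) atTop
      (𝓝 (tailIntegral f 1 - tailIntegral f 1)) := h.const_sub _
  rw [sub_self] at h2
  refine h2.congr' ?_
  filter_upwards [eventually_ge_atTop 1] with v hv
  rw [← intervalIntegral.integral_Ioi_sub_Ioi (hf.integrableOn 1 one_pos) hv]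
  simp [tailIntegral]

/-- Since `f'` is monotone, failure means `f' < C`, hence `f u ≤ C u`, and integrability of `1 / f`
would pass to `1 / u`. -/
theorem tendsto_deriv_atTop (hf : IsAdmissible f) : Tendsto (deriv f) atTop atTop := by
  refine tendsto_atTop.2 fun C => ?_
  by_contra hC
  have hlt : ∀ u, 0 < u → deriv f u < C := by
    intro u hu
    by_contra! h
    refine hC ?_
    filter_upwards [eventually_ge_atTop u] with v hv
    exact h.trans (hf.strictMonoOn_deriv.monotoneOn hu.le (hu.le.trans hv) hv)
  have hCpos : 0 < C := (hf.deriv_pos 1 one_pos).trans (hlt 1 one_pos)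
  have hle : ∀ u, 0 < u → f u ≤ C * u := by
    intro u hu
    have := hf.sub_le_deriv_mul le_rfl hu
    rw [hf.map_zero] at this
    nlinarith [hlt u hu]
  refine not_integrableOn_Ioi_inv (a := 1) ?_
  have h1 := (hf.integrableOn 1 one_pos).const_mul C
  refine h1.mono' (by fun_prop) ?_
  refine (ae_restrict_iff' measurableSet_Ioi).2 (Eventually.of_forall fun x hx => ?_)
  have hx0 : 0 < x := one_pos.trans hx
  rw [Real.norm_of_nonneg (by positivity), mul_one_div, le_div_iff₀ (hf.pos x hx0),
    inv_mul_le_iff₀ hx0, mul_comm]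
  exact hle x hx0

theorem hasDerivAt_inv_deriv (hf : IsAdmissible f) {u : ℝ} (hu : 0 < u) :
    HasDerivAt (fun v => (deriv f v)⁻¹) (-deriv (deriv f) u / deriv f u ^ 2) u :=
  (hf.hasDerivAt_deriv hu).inv (hf.deriv_pos u hu).ne'

end IsAdmissible

/-- An antitone function on `(0, ∞)` that tends to `0` at infinity is nonnegative. -/
theorem nonneg_of_hasDerivAt_nonpos_of_tendsto {g g' : ℝ → ℝ}
    (hg : ∀ u, 0 < u → HasDerivAt g (g' u) u) (hg' : ∀ u, 0 < u → g' u ≤ 0)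
    (hlim : Tendsto g atTop (𝓝 0)) {u : ℝ} (hu : 0 < u) : 0 ≤ g u := by
  have hanti : AntitoneOn g (Ioi 0) := by
    refine antitoneOn_of_deriv_nonpos (convex_Ioi 0)
      (fun x hx => (hg x hx).continuousAt.continuousWithinAt) ?_ ?_
    · rw [interior_Ioi]
      exact fun x hx => (hg x hx).differentiableAt.differentiableWithinAt
    · rw [interior_Ioi]
      intro x hx
      rw [(hg x hx).deriv]
      exact hg' x hx
  refine le_of_tendsto hlim ?_
  filter_upwards [eventually_ge_atTop u] with v hv
  exact hanti hu (hu.trans_le hv) hv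

/-! ### Two-sided bound on `f' F` -/

namespace IsAdmissible

variable {f : ℝ → ℝ}

theorem tendsto_inv_deriv (hf : IsAdmissible f) :
    Tendsto (fun v => (deriv f v)⁻¹) atTop (𝓝 0) := hf.tendsto_deriv_atTop.inv_tendsto_atTop

/-- `F - q / f'` has derivative `(q f f'' - f'²) / (f f'²) ≤ 0` and tends to `0` at infinity, so it
is nonnegative. The upper bound is the same argument with signs reversed. -/
theorem le_deriv_mul_tailIntegral (hf : IsAdmissible f) {q : ℝ}
    (hq : ∀ u : ℝ, 0 < u → q ≤ deriv f u ^ 2 / (f u * deriv (deriv f) u)) {u : ℝ} (hu : 0 < u) :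
    q ≤ deriv f u * tailIntegral f u := by
  have h := nonneg_of_hasDerivAt_nonpos_of_tendsto
    (g := fun v => tailIntegral f v - q * (deriv f v)⁻¹)
    (fun v hv => (hf.hasDerivAt_tailIntegral hv).sub ((hf.hasDerivAt_inv_deriv hv).const_mul q))
    (fun v hv => ?_)
    (by simpa using hf.tendsto_tailIntegral.sub (hf.tendsto_inv_deriv.const_mul q)) hu
  · have hd := hf.deriv_pos u hu
    have := mul_nonneg hd.le h
    field_simp at this
    linarith
  · have h1 := hf.pos v hv
    have h2 := hf.deriv_pos v hv
    have h3 := hf.deriv_deriv_pos v hv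
    have := hq v hv
    rw [le_div_iff₀ (by positivity)] at this
    have e : -(1 / f v) - q * (-deriv (deriv f) v / deriv f v ^ 2)
      = (q * (f v * deriv (deriv f) v) - deriv f v ^ 2) / (f v * deriv f v ^ 2) := by
      field_simp
      ring
    rw [e]
    exact div_nonpos_of_nonpos_of_nonneg (by linarith) (by positivity)

theorem deriv_mul_tailIntegral_le (hf : IsAdmissible f) {q : ℝ}
    (hq : ∀ u : ℝ, 0 < u → deriv f u ^ 2 / (f u * deriv (deriv f) u) ≤ q) {u : ℝ} (hu : 0 < u) :
    deriv f u * tailIntegral f u ≤ q := by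
  have h := nonneg_of_hasDerivAt_nonpos_of_tendsto
    (g := fun v => q * (deriv f v)⁻¹ - tailIntegral f v)
    (fun v hv => ((hf.hasDerivAt_inv_deriv hv).const_mul q).sub (hf.hasDerivAt_tailIntegral hv))
    (fun v hv => ?_)
    (by simpa using (hf.tendsto_inv_deriv.const_mul q).sub hf.tendsto_tailIntegral) hu
  · have hd := hf.deriv_pos u hu
    have := mul_nonneg hd.le h
    field_simp at this
    linarith
  · have h1 := hf.pos v hv
    have h2 := hf.deriv_pos v hv
    have h3 := hf.deriv_deriv_pos v hv
    have := hq v hv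
    rw [div_le_iff₀ (by positivity)] at this
    have e : q * (-deriv (deriv f) v / deriv f v ^ 2) - -(1 / f v)
      = (deriv f v ^ 2 - q * (f v * deriv (deriv f) v)) / (f v * deriv f v ^ 2) := by
      field_simp
      ring
    rw [e]
    exact div_nonpos_of_nonpos_of_nonneg (by linarith) (by positivity)

end IsAdmissible

/-! ### Differential inequalities of Hardy and Euler type on `(0, R)` -/

/-- A function with nonnegative derivative on `(0, R)` that tends to `0` at `0` is nonnegative. -/
theorem nonneg_of_hasDerivAt_nonneg_of_tendsto {R : ℝ} {g g' : ℝ → ℝ}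
    (hg : ∀ r ∈ Ioo 0 R, HasDerivAt g (g' r) r) (hg' : ∀ r ∈ Ioo 0 R, 0 ≤ g' r)
    (hlim : Tendsto g (𝓝[>] 0) (𝓝 0)) {r : ℝ} (hr : r ∈ Ioo 0 R) : 0 ≤ g r := by
  have hmono : MonotoneOn g (Ioo 0 R) := by
    refine monotoneOn_of_deriv_nonneg (convex_Ioo 0 R)
      (fun x hx => (hg x hx).continuousAt.continuousWithinAt) ?_ ?_
    · rw [interior_Ioo]
      exact fun x hx => (hg x hx).differentiableAt.differentiableWithinAt
    · rw [interior_Ioo]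
      intro x hx
      rw [(hg x hx).deriv]
      exact hg' x hx
  refine le_of_tendsto hlim ?_
  filter_upwards [Ioo_mem_nhdsGT hr.1] with v hv
  exact hmono ⟨hv.1, hv.2.trans hr.2⟩ hr hv.2.le

theorem tendsto_rpow_nhdsGT_zero {c : ℝ} (hc : 0 < c) :
    Tendsto (fun r : ℝ => r ^ c) (𝓝[>] 0) (𝓝 0) := by
  have h : ContinuousAt (fun r : ℝ => r ^ c) 0 := Real.continuousAt_rpow_const _ _ (Or.inr hc.le)
  have h2 := h.tendsto
  rw [Real.zero_rpow hc.ne'] at h2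
  exact h2.mono_left nhdsWithin_le_nhds

/-- A subsolution `z` of the Hardy operator `-z'' - (2 γ + 1) / r z' - γ² / r² z` that is regular at
the origin and positive on `(0, R)` is positive at `R`. -/
theorem pos_of_hardy_subsolution {γ R : ℝ} (hγ : 0 < γ) (hR : 0 < R) {z z₁ z₂ : ℝ → ℝ}
    {l l₁ : ℝ} (hz : ∀ r ∈ Ioo 0 R, HasDerivAt z (z₁ r) r)
    (hz₁ : ∀ r ∈ Ioo 0 R, HasDerivAt z₁ (z₂ r) r)
    (hsub : ∀ r ∈ Ioo 0 R, 0 ≤ z₂ r + (2 * γ + 1) / r * z₁ r + γ ^ 2 / r ^ 2 * z r)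
    (hl : Tendsto z (𝓝[>] 0) (𝓝 l)) (hl₁ : Tendsto z₁ (𝓝[>] 0) (𝓝 l₁))
    (hcont : ContinuousAt z R) (hpos : ∀ r ∈ Ioo 0 R, 0 < z r) : 0 < z R := by
  have hrpow : ∀ r : ℝ, 0 < r → HasDerivAt (fun r : ℝ => r ^ γ) (γ * r ^ γ / r) r := by
    intro r hr
    have := Real.hasDerivAt_rpow_const (x := r) (p := γ) (Or.inl hr.ne')
    rwa [Real.rpow_sub_one hr.ne', ← mul_div_assoc] at this
  -- The operator is `r⁻² (r d/dr + γ)²`, a double root, so the integrating factor `r ^ γ` is used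
  -- twice: here for the outer factor, and in `hmono` for the inner one.
  have hA : ∀ r ∈ Ioo 0 R, 0 ≤ r ^ γ * (r * z₁ r + γ * z r) := by
    intro r hr
    refine nonneg_of_hasDerivAt_nonneg_of_tendsto (R := R)
      (g := fun r => r ^ γ * (r * z₁ r + γ * z r))
      (fun r hr => (hrpow r hr.1).mul
        (((hasDerivAt_id r).mul (hz₁ r hr)).add ((hz r hr).const_mul γ))) ?_ ?_ hr
    · intro r hr
      have hr0 : 0 < r := hr.1
      have e : γ * r ^ γ / r * (r * z₁ r + γ * z r) +
          r ^ γ * ((1 * z₁ r + r * z₂ r) + γ * z₁ r) =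
          r ^ γ * r * (z₂ r + (2 * γ + 1) / r * z₁ r + γ ^ 2 / r ^ 2 * z r) := by
        field_simp
        ring
      have := hsub r hr
      simp only [id]
      have h3 : 0 ≤ r ^ γ * r * (z₂ r + (2 * γ + 1) / r * z₁ r + γ ^ 2 / r ^ 2 * z r) := by
        positivity
      rw [← e] at h3
      exact h3
    · have h0 : Tendsto (fun r : ℝ => r) (𝓝[>] 0) (𝓝 0) :=
        tendsto_id.mono_left nhdsWithin_le_nhds
      simpa using (tendsto_rpow_nhdsGT_zero hγ).mul ((h0.mul hl₁).add (hl.const_mul γ))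
  have hmono : MonotoneOn (fun r : ℝ => r ^ γ * z r) (Ioo 0 R) := by
    have hd : ∀ r ∈ Ioo 0 R, HasDerivAt (fun r : ℝ => r ^ γ * z r)
        (r ^ γ * (r * z₁ r + γ * z r) / r) r := by
      intro r hr
      have hr0 : 0 < r := hr.1
      refine ((hrpow r hr.1).mul (hz r hr)).congr_deriv ?_
      field_simp
      ring
    refine monotoneOn_of_deriv_nonneg (convex_Ioo 0 R)
      (fun x hx => (hd x hx).continuousAt.continuousWithinAt) ?_ ?_
    · rw [interior_Ioo]
      exact fun x hx => (hd x hx).differentiableAt.differentiableWithinAt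
    · rw [interior_Ioo]
      intro x hx
      rw [(hd x hx).deriv]
      exact div_nonneg (hA x hx) hx.1.le
  have hmem : R / 2 ∈ Ioo 0 R := ⟨by linarith, by linarith⟩
  have hge : (R / 2) ^ γ * z (R / 2) ≤ R ^ γ * z R := by
    have ht : Tendsto (fun r : ℝ => r ^ γ * z r) (𝓝[<] R) (𝓝 (R ^ γ * z R)) :=
      ((Real.continuousAt_rpow_const _ _ (Or.inl hR.ne')).mul hcont).tendsto.mono_left
        nhdsWithin_le_nhds
    refine ge_of_tendsto ht ?_
    filter_upwards [Ioo_mem_nhdsLT hmem.2] with v hv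
    exact hmono hmem ⟨hmem.1.trans hv.1, hv.2⟩ hv.1.le
  have h1 : 0 < (R / 2) ^ γ * z (R / 2) :=
    mul_pos (Real.rpow_pos_of_pos hmem.1 _) (hpos _ hmem)
  exact pos_of_mul_pos_right (h1.trans_le hge) (Real.rpow_nonneg hR.le _)

/-- Continuous induction for positivity on `[0, ∞)`. -/
theorem pos_of_forall_pos_on_Ico {z : ℝ → ℝ} (hz : ContinuousOn z (Ici 0)) (h0 : 0 < z 0)
    (hstep : ∀ R, 0 < R → (∀ r ∈ Ico 0 R, 0 < z r) → 0 < z R) {r : ℝ} (hr : 0 ≤ r) : 0 < z r := by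
  by_contra hneg
  set S : Set ℝ := Ici 0 ∩ z ⁻¹' Iic 0 with hS
  have hne : S.Nonempty := ⟨r, hr, not_lt.1 hneg⟩
  have hclosed : IsClosed S := hz.preimage_isClosed_of_isClosed isClosed_Ici isClosed_Iic
  have hbdd : BddBelow S := ⟨0, fun x hx => hx.1⟩
  have hmem : sInf S ∈ S := hclosed.csInf_mem hne hbdd
  have hpos : 0 < sInf S := by
    refine lt_of_le_of_ne hmem.1 fun h => ?_
    have h2 : z (sInf S) ≤ 0 := hmem.2
    rw [← h] at h2
    exact absurd h0 (not_lt.2 h2)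
  have := hstep _ hpos fun x hx => by
    by_contra hx2
    exact absurd (csInf_le hbdd ⟨hx.1, not_lt.1 hx2⟩) (not_le.2 hx.2)
  exact absurd this (not_lt.2 hmem.2)

/-- If `r p' + (l₁ + l₂) p + l₁ l₂ g ≥ 0` with `p = r g'`, where `g` grows at most
logarithmically and `p` is bounded at the origin, then `g ≥ 0`. -/
theorem nonneg_of_euler_inequality {l₁ l₂ R c C : ℝ} (hl₁ : 0 < l₁) (hl₂ : 0 < l₂)
    {g p p' : ℝ → ℝ} (hg : ∀ r ∈ Ioo 0 R, HasDerivAt g (p r / r) r)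
    (hp : ∀ r ∈ Ioo 0 R, HasDerivAt p (p' r) r)
    (hineq : ∀ r ∈ Ioo 0 R, 0 ≤ r * p' r + (l₁ + l₂) * p r + l₁ * l₂ * g r)
    (hpl : Tendsto p (𝓝[>] 0) (𝓝 c))
    (hgl : Tendsto (fun r => g r + 2 * Real.log r) (𝓝[>] 0) (𝓝 C))
    {r : ℝ} (hr : r ∈ Ioo 0 R) : 0 ≤ g r := by
  have hrpow : ∀ l r : ℝ, 0 < r → HasDerivAt (fun r : ℝ => r ^ l) (l * r ^ l / r) r := by
    intro l r hr
    have := Real.hasDerivAt_rpow_const (x := r) (p := l) (Or.inl hr.ne')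
    rwa [Real.rpow_sub_one hr.ne', ← mul_div_assoc] at this
  -- The singularity `-2 log r` of `g` is absorbed by any positive power, which removes the boundary
  -- terms at the origin.
  have hglim : ∀ l : ℝ, 0 < l → Tendsto (fun r => r ^ l * g r) (𝓝[>] 0) (𝓝 0) := by
    intro l hl
    have h1 := (tendsto_rpow_nhdsGT_zero hl).mul hgl
    have h2 := (tendsto_log_mul_rpow_nhdsGT_zero hl).const_mul 2
    have h3 := h1.sub h2
    simp only [zero_mul, mul_zero, sub_zero] at h3
    refine h3.congr fun x => ?_
    ring
  -- The inequality reads `(r d/dr + l₁)(r d/dr + l₂) g ≥ 0`; the `l₁` factor is inverted here, the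
  -- `l₂` factor in `hB`.
  have hA : ∀ r ∈ Ioo 0 R, 0 ≤ r ^ l₁ * (p r + l₂ * g r) := by
    intro r hr
    refine nonneg_of_hasDerivAt_nonneg_of_tendsto (R := R)
      (g := fun r => r ^ l₁ * (p r + l₂ * g r))
      (fun r hr => (hrpow l₁ r hr.1).mul ((hp r hr).add ((hg r hr).const_mul l₂))) ?_ ?_ hr
    · intro r hr
      have hr0 : 0 < r := hr.1
      have e : l₁ * r ^ l₁ / r * (p r + l₂ * g r) + r ^ l₁ * (p' r + l₂ * (p r / r)) =
          r ^ l₁ / r * (r * p' r + (l₁ + l₂) * p r + l₁ * l₂ * g r) := by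
        field_simp
        ring
      have := hineq r hr
      have h3 : 0 ≤ r ^ l₁ / r * (r * p' r + (l₁ + l₂) * p r + l₁ * l₂ * g r) := by
        positivity
      rw [← e] at h3
      exact h3
    · have h3 := ((tendsto_rpow_nhdsGT_zero hl₁).mul hpl).add ((hglim l₁ hl₁).const_mul l₂)
      simp only [zero_mul, mul_zero, add_zero] at h3
      refine h3.congr fun x => ?_
      ring
  have hB : 0 ≤ r ^ l₂ * g r := by
    refine nonneg_of_hasDerivAt_nonneg_of_tendsto (R := R)
      (g := fun r => r ^ l₂ * g r)
      (fun r hr => (hrpow l₂ r hr.1).mul (hg r hr)) ?_ (hglim l₂ hl₂) hr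
    intro r hr
    have hr0 : 0 < r := hr.1
    have h1 : 0 ≤ p r + l₂ * g r :=
      nonneg_of_mul_nonneg_right (hA r hr) (Real.rpow_pos_of_pos hr0 _)
    have e : l₂ * r ^ l₂ / r * g r + r ^ l₂ * (p r / r) = r ^ l₂ / r * (p r + l₂ * g r) := by
      ring
    rw [e]
    positivity
  exact nonneg_of_mul_nonneg_right hB (Real.rpow_pos_of_pos hr.1 _)

/-! ### The Joseph–Lundgren threshold and the pointwise bound on `F(u)` -/

/-- Below the Joseph–Lundgren threshold the quadratic `l² - (N + 2 - 4 q) l + (2 N - 4 q)` has two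
positive real roots. -/
theorem exists_pos_roots_of_le_qJL {N : ℕ} (hN : 11 ≤ N) {q : ℝ} (hq : q ≤ qJL N) :
    ∃ l₁ l₂ : ℝ, 0 < l₁ ∧ 0 < l₂ ∧ l₁ + l₂ = N + 2 - 4 * q ∧ l₁ * l₂ = 2 * N - 4 * q := by
  have hN' : (11 : ℝ) ≤ N := by exact_mod_cast hN
  rw [qJL] at hq
  have hs := Real.sqrt_nonneg ((N : ℝ) - 1)
  have hs2 := Real.sq_sqrt (show (0 : ℝ) ≤ (N : ℝ) - 1 by linarith)
  set s := Real.sqrt ((N : ℝ) - 1)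
  have h4 : 2 * s ≤ N - 4 * q := by linarith
  -- With `t = N - 4 q` the discriminant is `(t + 2)² - 4 (t + N) = t² - 4 (N - 1)`.
  have hdisc : 0 ≤ (N - 4 * q) ^ 2 - 4 * s ^ 2 := by nlinarith
  have hd := Real.sq_sqrt hdisc
  have hd0 := Real.sqrt_nonneg ((N - 4 * q) ^ 2 - 4 * s ^ 2)
  set d := Real.sqrt ((N - 4 * q) ^ 2 - 4 * s ^ 2)
  have hdle : d ≤ N - 4 * q := by nlinarith
  refine ⟨(N + 2 - 4 * q + d) / 2, (N + 2 - 4 * q - d) / 2, by linarith, by linarith, by ring, ?_⟩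
  nlinarith

/-- The key pointwise bound: `F(u(r)) ≥ r² / (2 N - 4 q₁)` as long as `u > 0`. -/
theorem IsAdmissible.sq_le_mul_tailIntegral {f : ℝ → ℝ} (hf : IsAdmissible f) {N : ℕ}
    (hN : 11 ≤ N) {q : ℝ} (hq1 : 1 ≤ q) (hqJ : q ≤ qJL N)
    (hq : ∀ u : ℝ, 0 < u → q ≤ deriv f u * tailIntegral f u)
    {R α : ℝ} (hα : 0 < α) {u u₁ u₂ : ℝ → ℝ} (hu : ∀ r ∈ Ioo 0 R, HasDerivAt u (u₁ r) r)
    (hu₁ : ∀ r ∈ Ioo 0 R, HasDerivAt u₁ (u₂ r) r)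
    (hode : ∀ r ∈ Ioo 0 R, u₂ r + ((N : ℝ) - 1) / r * u₁ r + f (u r) = 0)
    (hl : Tendsto u (𝓝[>] 0) (𝓝 α)) (hl₁ : Tendsto u₁ (𝓝[>] 0) (𝓝 0))
    (hpos : ∀ r ∈ Ioo 0 R, 0 < u r) {r : ℝ} (hr : r ∈ Ioo 0 R) :
    r ^ 2 ≤ (2 * N - 4 * q) * tailIntegral f (u r) := by
  obtain ⟨l₁, l₂, hl₁0, hl₂0, hsum, hprod⟩ := exists_pos_roots_of_le_qJL hN hqJ
  have hb : 0 < 2 * (N : ℝ) - 4 * q := hprod ▸ mul_pos hl₁0 hl₂0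
  set b := 2 * (N : ℝ) - 4 * q with hbdef
  set w : ℝ → ℝ := fun r => tailIntegral f (u r) with hw
  set w₁ : ℝ → ℝ := fun r => -(u₁ r / f (u r)) with hw₁
  have hwpos : ∀ r ∈ Ioo 0 R, 0 < w r := fun r hr => hf.tailIntegral_pos (hpos r hr)
  have hwd : ∀ r ∈ Ioo 0 R, HasDerivAt w (w₁ r) r := by
    intro r hr
    have := (hf.hasDerivAt_tailIntegral (hpos r hr)).comp r (hu r hr)
    refine this.congr_deriv ?_
    simp only [hw₁]
    ring
  -- The substitution `w = F(u)` turns the source `f(u)` into the constant `1`; `f` survives only in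
  -- the gradient term.
  have hw₁d : ∀ r ∈ Ioo 0 R, HasDerivAt w₁
      (-((N : ℝ) - 1) / r * w₁ r + 1 + deriv f (u r) * w₁ r ^ 2) r := by
    intro r hr
    have hfu := (hf.pos _ (hpos r hr)).ne'
    have hr0 : r ≠ 0 := hr.1.ne'
    have := ((hu₁ r hr).div ((hf.hasDerivAt (u r)).comp r (hu r hr)) hfu).neg
    refine this.congr_deriv ?_
    have hu2 : u₂ r = -(((N : ℝ) - 1) / r * u₁ r) - f (u r) := by linarith [hode r hr]
    simp only [hw₁, Function.comp, hu2]
    field_simp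
    ring
  have hFα : ContinuousAt (tailIntegral f) α := (hf.hasDerivAt_tailIntegral hα).continuousAt
  have hwl : Tendsto w (𝓝[>] 0) (𝓝 (tailIntegral f α)) := hFα.tendsto.comp hl
  have hw₁l : Tendsto w₁ (𝓝[>] 0) (𝓝 0) := by
    have := (hl₁.div ((hf.continuous.tendsto α).comp hl) (hf.pos α hα).ne').neg
    simpa using this
  have h0 : Tendsto (fun r : ℝ => r) (𝓝[>] 0) (𝓝 0) :=
    tendsto_id.mono_left nhdsWithin_le_nhds
  -- `g = log (b w / r²)` and `p = r g'`.
  set g : ℝ → ℝ := fun r => Real.log (w r) + Real.log b - 2 * Real.log r with hg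
  set p : ℝ → ℝ := fun r => r * w₁ r / w r - 2 with hp
  have hmain : 0 ≤ g r := by
    refine nonneg_of_euler_inequality (l₁ := l₁) (l₂ := l₂) (R := R) (c := -2)
      (C := Real.log (tailIntegral f α) + Real.log b) hl₁0 hl₂0 (g := g) (p := p)
      (p' := fun r => ((1 * w₁ r + r * (-((N : ℝ) - 1) / r * w₁ r + 1 + deriv f (u r) * w₁ r ^ 2)) *
        w r - r * w₁ r * w₁ r) / w r ^ 2) ?_ ?_ ?_ ?_ ?_ hr
    · intro r hr
      have hr0 : r ≠ 0 := hr.1.ne'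
      have hw0 := (hwpos r hr).ne'
      have := (((hwd r hr).log hw0).add_const (Real.log b)).sub
        ((Real.hasDerivAt_log hr0).const_mul 2)
      refine this.congr_deriv ?_
      simp only [hp]
      field_simp
    · intro r hr
      exact (((hasDerivAt_id r).mul (hw₁d r hr)).div (hwd r hr) (hwpos r hr).ne').sub_const 2
    · intro r hr
      have hr0 : 0 < r := hr.1
      have hw0 := hwpos r hr
      have hexp : Real.exp (-g r) = r ^ 2 / (b * w r) := by
        rw [hg, Real.exp_neg, Real.exp_sub, Real.exp_add, Real.exp_log hw0, Real.exp_log hb,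
          two_mul, Real.exp_add, Real.exp_log hr0]
        field_simp
      have h1 : 1 - g r ≤ r ^ 2 / (b * w r) := by
        rw [← hexp]
        linarith [Real.add_one_le_exp (-g r)]
      have h2 : b * (1 - g r) ≤ r ^ 2 / w r := by
        have := mul_le_mul_of_nonneg_left h1 hb.le
        refine this.trans_eq ?_
        field_simp
      have hQ := hq (u r) (hpos r hr)
      have e : r * (((1 * w₁ r + r * (-((N : ℝ) - 1) / r * w₁ r + 1 +
          deriv f (u r) * w₁ r ^ 2)) * w r - r * w₁ r * w₁ r) / w r ^ 2) =
          -((N : ℝ) - 2) * (p r + 2) + r ^ 2 / w r +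
            (deriv f (u r) * w r - 1) * (p r + 2) ^ 2 := by
        simp only [hp]
        field_simp
        ring
      rw [e, hsum, hprod]
      have h3 : (q - 1) * (p r + 2) ^ 2 ≤ (deriv f (u r) * w r - 1) * (p r + 2) ^ 2 :=
        mul_le_mul_of_nonneg_right (by linarith) (sq_nonneg _)
      have h4 : 0 ≤ (q - 1) * p r ^ 2 := mul_nonneg (by linarith) (sq_nonneg _)
      -- Expanding `(p + 2)² = p² + 4 p + 4`, discarding `(q - 1) p²` and using `b e^{-g} ≥ b (1 -
      -- g)` leaves coefficient `N + 2 - 4 q` for `p`; the constants cancel because `b = 2 N - 4 q`.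
      nlinarith
    · have := (((h0.mul hw₁l).div hwl (hf.tailIntegral_pos hα).ne').sub_const 2)
      simpa using this
    · have := (hwl.log (hf.tailIntegral_pos hα).ne').add_const (Real.log b)
      refine this.congr fun x => ?_
      simp only [hg]
      ring
  have hr0 : 0 < r := hr.1
  have hw0 := hwpos r hr
  have h5 : Real.log (r ^ 2) ≤ Real.log (b * w r) := by
    rw [Real.log_mul hb.ne' hw0.ne', Real.log_pow]
    simp only [hg] at hmain
    push_cast
    linarith
  exact (Real.log_le_log_iff (by positivity) (by positivity)).1 h5

/-! ### Global existence for a bounded Lipschitz nonlinearity -/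

theorem continuous_integral_zero_one {F : ℝ → ℝ → ℝ} (hF : Continuous (Function.uncurry F)) :
    Continuous fun r => ∫ t in (0 : ℝ)..1, F r t :=
  intervalIntegral.continuous_parametric_intervalIntegral_of_continuous hF continuous_const

/-- The weighted mean `∫₀¹ sⁿ g(r s) ds`. -/
noncomputable def radialMean (n : ℕ) (g : ℝ → ℝ) (r : ℝ) : ℝ := ∫ s in (0 : ℝ)..1, s ^ n * g (r * s)

theorem continuous_radialMean (n : ℕ) {g : ℝ → ℝ} (hg : Continuous g) :
    Continuous (radialMean n g) := by
  refine continuous_integral_zero_one (F := fun r s => s ^ n * g (r * s)) ?_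
  simp only [Function.uncurry_def]
  fun_prop

/-- Rescaling `t = r s`. The mean is the integrated equation divided by its power of `r`, in a form
continuous at the origin and defined for every real `r`. -/
theorem pow_mul_radialMean (n : ℕ) (g : ℝ → ℝ) (r : ℝ) :
    r ^ (n + 1) * radialMean n g r = ∫ t in (0 : ℝ)..r, t ^ n * g t := by
  have h := intervalIntegral.smul_integral_comp_mul_left (a := 0) (b := 1)
    (fun t : ℝ => t ^ n * g t) r
  rw [mul_zero, mul_one] at h
  rw [← h, radialMean, smul_eq_mul, pow_succ', mul_assoc, ← intervalIntegral.integral_const_mul]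
  congr 1
  refine intervalIntegral.integral_congr fun s _ => ?_
  ring

theorem hasDerivAt_integral_zero {g : ℝ → ℝ} (hg : Continuous g) (r : ℝ) :
    HasDerivAt (fun r => ∫ t in (0 : ℝ)..r, g t) (g r) r :=
  intervalIntegral.integral_hasDerivAt_right (hg.intervalIntegrable _ _)
    hg.stronglyMeasurable.stronglyMeasurableAtFilter hg.continuousAt

theorem hasDerivAt_radialMean (n : ℕ) {g : ℝ → ℝ} (hg : Continuous g) {r : ℝ} (hr : 0 < r) :
    HasDerivAt (radialMean n g) ((g r - (n + 1) * radialMean n g r) / r) r := by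
  have h1 : HasDerivAt (fun r => ∫ t in (0 : ℝ)..r, t ^ n * g t) (r ^ n * g r) r :=
    hasDerivAt_integral_zero (g := fun t => t ^ n * g t) (by fun_prop) r
  have h2 : HasDerivAt (fun r : ℝ => r ^ (n + 1)) (((n + 1 : ℕ) : ℝ) * r ^ n) r := by
    simpa using hasDerivAt_pow (n + 1) r
  have h3 := h1.div h2 (pow_pos hr _).ne'
  have h4 : radialMean n g =ᶠ[𝓝 r]
      fun r => (∫ t in (0 : ℝ)..r, t ^ n * g t) / r ^ (n + 1) := by
    filter_upwards [Ioi_mem_nhds hr] with x hx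
    rw [← pow_mul_radialMean, mul_div_cancel_left₀ _ (pow_pos hx _).ne']
  refine (HasDerivAt.congr_of_eventuallyEq h3 h4).congr_deriv ?_
  rw [← pow_mul_radialMean]
  push_cast
  field_simp
  ring

theorem abs_radialMean_le (n : ℕ) {g : ℝ → ℝ} {r C : ℝ} (hg : ∀ s ∈ Icc (0 : ℝ) 1, |g (r * s)| ≤ C) :
    |radialMean n g r| ≤ C := by
  have := intervalIntegral.norm_integral_le_of_norm_le_const (a := 0) (b := 1) (C := C)
    (f := fun s => s ^ n * g (r * s)) ?_
  · simpa [radialMean] using this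
  · intro s hs
    rw [uIoc_of_le zero_le_one] at hs
    rw [Real.norm_eq_abs, abs_mul, abs_of_nonneg (pow_nonneg hs.1.le n)]
    exact (mul_le_of_le_one_left (abs_nonneg _) (pow_le_one₀ hs.1.le hs.2)).trans
      (hg s ⟨hs.1.le, hs.2⟩)

theorem radialMean_sub (n : ℕ) {g h : ℝ → ℝ} (hg : Continuous g) (hh : Continuous h) (r : ℝ) :
    radialMean n g r - radialMean n h r = radialMean n (fun x => g x - h x) r := by
  rw [radialMean, radialMean, radialMean, ← intervalIntegral.integral_sub]
  · simp only [mul_sub]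
  · exact Continuous.intervalIntegrable (by fun_prop) _ _
  · exact Continuous.intervalIntegrable (by fun_prop) _ _

/-- The factor `1 / (2 k)` gained on the Gaussian weight is what makes the integral operator
contract. -/
theorem sq_mul_radialMean_one_exp {k : ℝ} (hk : 0 < k) (r : ℝ) :
    r ^ 2 * radialMean 1 (fun x => Real.exp (k * x ^ 2)) r = (Real.exp (k * r ^ 2) - 1) / (2 * k) := by
  rw [pow_mul_radialMean 1]
  have hd : ∀ x ∈ uIcc 0 r, HasDerivAt (fun x => Real.exp (k * x ^ 2) / (2 * k))
      (x ^ 1 * Real.exp (k * x ^ 2)) x := by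
    intro x _
    have := (((hasDerivAt_pow 2 x).const_mul k).exp).div_const (2 * k)
    refine this.congr_deriv ?_
    field_simp
    norm_num
    ring
  rw [intervalIntegral.integral_eq_sub_of_hasDerivAt hd
    (Continuous.intervalIntegrable (by fun_prop) _ _)]
  simp
  ring

/-- The integral operator of the radial problem with a bounded Lipschitz nonlinearity has a fixed
point, by contraction in a norm with Gaussian weight. -/
theorem exists_radial_integral_solution (n : ℕ) {h : ℝ → ℝ} {K : NNReal} (hK : LipschitzWith K h)
    {M : ℝ} (hM : ∀ x, |h x| ≤ M) (α : ℝ) :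
    ∃ u : ℝ → ℝ, Continuous u ∧
      ∀ r, u r = α - r ^ 2 * radialMean 1 (radialMean n fun x => h (u x)) r := by
  have hc : Continuous h := hK.continuous
  -- Any positive `k ≥ K` works: the contraction factor is at most `K / (2 k) ≤ 1 / 2`.
  set k : ℝ := K + 1 with hk
  have hk0 : 0 < k := by positivity
  have hM0 : 0 ≤ M := (abs_nonneg _).trans (hM 0)
  set w : ℝ → ℝ := fun r => Real.exp (k * r ^ 2) with hw
  have hwc : Continuous w := by fun_prop
  have hwpos : ∀ r, 0 < w r := fun r => Real.exp_pos _
  have hw1 : ∀ r, 1 ≤ w r := fun r => Real.one_le_exp (by positivity)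
  -- The unknown is `y = u / w`, so the weighted norm of `u` becomes the sup norm of `y`.
  set I : BoundedContinuousFunction ℝ ℝ → ℝ → ℝ := fun y =>
    radialMean n fun x => h (w x * y x) with hI
  have hIc0 : ∀ y : BoundedContinuousFunction ℝ ℝ, Continuous fun x => h (w x * y x) :=
    fun y => hc.comp (hwc.mul y.continuous)
  have hIc : ∀ y, Continuous (I y) := fun y => continuous_radialMean n (hIc0 y)
  have hIb : ∀ y r, |I y r| ≤ M := fun y r => abs_radialMean_le n fun _ _ => hM _
  have hTc : ∀ y, Continuous fun r => (α - r ^ 2 * radialMean 1 (I y) r) / w r := fun y =>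
    (continuous_const.sub ((continuous_pow 2).mul (continuous_radialMean 1 (hIc y)))).div hwc
      fun r => (hwpos r).ne'
  have hTb : ∀ y r, ‖(α - r ^ 2 * radialMean 1 (I y) r) / w r‖ ≤ |α| + M / k := by
    intro y r
    rw [Real.norm_eq_abs, abs_div, abs_of_pos (hwpos r), div_le_iff₀ (hwpos r)]
    have h1 : |radialMean 1 (I y) r| ≤ M := abs_radialMean_le 1 fun _ _ => hIb y _
    have h2 : k * r ^ 2 ≤ w r := by
      have := Real.add_one_le_exp (k * r ^ 2)
      simp only [hw]
      linarith
    have h3 : r ^ 2 ≤ w r / k := by rwa [le_div_iff₀ hk0, mul_comm]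
    calc |α - r ^ 2 * radialMean 1 (I y) r| ≤ |α| + |r ^ 2 * radialMean 1 (I y) r| := abs_sub _ _
      _ = |α| + r ^ 2 * |radialMean 1 (I y) r| := by rw [abs_mul, abs_of_nonneg (sq_nonneg r)]
      _ ≤ |α| * w r + w r / k * M := by
        refine add_le_add (le_mul_of_one_le_right (abs_nonneg _) (hw1 r)) ?_
        exact mul_le_mul h3 h1 (abs_nonneg _) (div_nonneg (hwpos r).le hk0.le)
      _ = (|α| + M / k) * w r := by ring
  set T : BoundedContinuousFunction ℝ ℝ → BoundedContinuousFunction ℝ ℝ := fun y =>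
    BoundedContinuousFunction.ofNormedAddCommGroup _ (hTc y) _ (hTb y) with hT
  have hTapp : ∀ y r, T y r = (α - r ^ 2 * radialMean 1 (I y) r) / w r := fun y r => rfl
  have hcontr : ContractingWith (1 / 2) T := by
    refine ⟨by norm_num [← NNReal.coe_lt_coe], LipschitzWith.of_dist_le_mul fun y z => ?_⟩
    rw [BoundedContinuousFunction.dist_le (by positivity)]
    intro r
    set D := dist y z with hD
    have hyz : ∀ x, |y x - z x| ≤ D := fun x => by
      rw [← Real.dist_eq]
      exact BoundedContinuousFunction.dist_coe_le_dist x
    have h1 : ∀ x, |I y x - I z x| ≤ K * D * w x := by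
      intro x
      rw [hI, radialMean_sub n (hIc0 y) (hIc0 z)]
      refine abs_radialMean_le n fun s hs => ?_
      have h2 := hK.dist_le_mul (w (x * s) * y (x * s)) (w (x * s) * z (x * s))
      rw [Real.dist_eq, Real.dist_eq, ← mul_sub, abs_mul, abs_of_pos (hwpos _)] at h2
      refine h2.trans ?_
      rw [mul_assoc]
      refine mul_le_mul_of_nonneg_left ?_ K.coe_nonneg
      rw [mul_comm]
      refine mul_le_mul (hyz _) ?_ (hwpos _).le dist_nonneg
      refine Real.exp_le_exp.2 (mul_le_mul_of_nonneg_left ?_ hk0.le)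
      rw [mul_pow]
      exact mul_le_of_le_one_right (sq_nonneg x) (pow_le_one₀ hs.1 hs.2)
    have h2 : |radialMean 1 (I y) r - radialMean 1 (I z) r| ≤ K * D * radialMean 1 w r := by
      rw [radialMean_sub 1 (hIc y) (hIc z), radialMean, radialMean,
        ← intervalIntegral.integral_const_mul, ← Real.norm_eq_abs]
      refine intervalIntegral.norm_integral_le_of_norm_le zero_le_one ?_
        (Continuous.intervalIntegrable (by fun_prop) _ _)
      refine Eventually.of_forall fun s hs => ?_
      rw [Real.norm_eq_abs, abs_mul, abs_of_nonneg (pow_nonneg hs.1.le 1)]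
      have := mul_le_mul_of_nonneg_left (h1 (r * s)) (pow_nonneg hs.1.le 1)
      linarith
    have h3 := sq_mul_radialMean_one_exp hk0 r
    rw [Real.dist_eq, hTapp, hTapp, ← sub_div, abs_div, abs_of_pos (hwpos r),
      div_le_iff₀ (hwpos r)]
    have e : α - r ^ 2 * radialMean 1 (I y) r - (α - r ^ 2 * radialMean 1 (I z) r) =
        -(r ^ 2 * (radialMean 1 (I y) r - radialMean 1 (I z) r)) := by ring
    rw [e, abs_neg, abs_mul, abs_of_nonneg (sq_nonneg r)]
    have hD0 : 0 ≤ D := dist_nonneg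
    calc r ^ 2 * |radialMean 1 (I y) r - radialMean 1 (I z) r|
        ≤ r ^ 2 * (K * D * radialMean 1 w r) := mul_le_mul_of_nonneg_left h2 (sq_nonneg r)
      _ = K * D * ((w r - 1) / (2 * k)) := by rw [← h3]; ring
      _ ≤ k * D * (w r / (2 * k)) := by
        have : (K : ℝ) ≤ k := by simp [hk]
        gcongr
        · exact div_nonneg (by linarith [hw1 r]) (by positivity)
        · linarith
      _ = ((1 / 2 : NNReal) : ℝ) * D * w r := by
        push_cast
        field_simp
  set y := ContractingWith.fixedPoint T hcontr
  have hy : T y = y := hcontr.fixedPoint_isFixedPt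
  refine ⟨fun x => w x * y x, hwc.mul y.continuous, fun r => ?_⟩
  have h1 : y r = (α - r ^ 2 * radialMean 1 (I y) r) / w r := by
    rw [← hTapp, hy]
  simp only
  rw [h1, mul_div_cancel₀ _ (hwpos r).ne']

/-- Global solvability of the radial problem with a bounded Lipschitz nonlinearity; the solution
satisfies `u' = -r m` with `m` continuous. -/
theorem exists_radial_solution_of_lipschitz (n : ℕ) {h : ℝ → ℝ} {K : NNReal}
    (hK : LipschitzWith K h) {M : ℝ} (hM : ∀ x, |h x| ≤ M) (α : ℝ) :
    ∃ u m : ℝ → ℝ, u 0 = α ∧ Continuous m ∧ (∀ r, HasDerivAt u (-(r * m r)) r) ∧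
      (∀ r, 0 < r → HasDerivAt m ((h (u r) - (n + 1) * m r) / r) r) ∧
      m = radialMean n fun x => h (u x) := by
  obtain ⟨u, huc, hu⟩ := exists_radial_integral_solution n hK hM α
  have hhu : Continuous fun x => h (u x) := hK.continuous.comp huc
  have hmc := continuous_radialMean n hhu
  refine ⟨u, radialMean n fun x => h (u x), by simpa using hu 0, hmc, fun r => ?_,
    fun r hr => hasDerivAt_radialMean n hhu hr, rfl⟩
  have h1 : u = fun r => α - ∫ t in (0 : ℝ)..r, t ^ 1 * radialMean n (fun x => h (u x)) t := by
    funext r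
    rw [← pow_mul_radialMean]
    exact hu r
  have h2 := (hasDerivAt_integral_zero
    (g := fun t => t ^ 1 * radialMean n (fun x => h (u x)) t) (by fun_prop) r).const_sub α
  rw [← h1] at h2
  simpa using h2

theorem radialMean_nonneg (n : ℕ) {g : ℝ → ℝ} (hg : ∀ x, 0 ≤ g x) (r : ℝ) : 0 ≤ radialMean n g r :=
  intervalIntegral.integral_nonneg zero_le_one fun _ hs => mul_nonneg (pow_nonneg hs.1 n) (hg _)

theorem radialMean_zero (n : ℕ) (g : ℝ → ℝ) : radialMean n g 0 = g 0 / (n + 1) := by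
  simp [radialMean, intervalIntegral.integral_mul_const]
  ring

/-! ### Hardy's inequality -/

section Hardy

variable {N : ℕ}

local notation "E" => EuclideanSpace ℝ (Fin N)

theorem integral_mul_fderiv_apply_eq_neg {g X : E → ℝ} (hg : ContDiff ℝ 1 g)
    (hgc : HasCompactSupport g) (hX : ContDiff ℝ 1 X) (v : E) :
    ∫ x, fderiv ℝ g x v * X x = -∫ x, g x * fderiv ℝ X x v := by
  have hc : Continuous fun x => fderiv ℝ g x v :=
    (hg.continuous_fderiv (by norm_num)).clm_apply continuous_const
  have hc2 : Continuous fun x => fderiv ℝ X x v :=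
    (hX.continuous_fderiv (by norm_num)).clm_apply continuous_const
  have hcs : HasCompactSupport fun x => fderiv ℝ g x v := hgc.fderiv_apply ℝ v
  have h := integral_mul_fderiv_eq_neg_fderiv_mul_of_integrable (μ := volume) (f := g) (g := X)
    (v := v) ((hc.mul hX.continuous).integrable_of_hasCompactSupport hcs.mul_right)
    ((hg.continuous.mul hc2).integrable_of_hasCompactSupport hgc.mul_right)
    ((hg.continuous.mul hX.continuous).integrable_of_hasCompactSupport hgc.mul_right)
    (fun x _ => hg.differentiable (by norm_num) x) (fun x _ => hX.differentiable (by norm_num) x)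
  rw [h, neg_neg]

theorem hasFDerivAt_norm_sq (x : E) :
    HasFDerivAt (fun x : E => ‖x‖ ^ 2) (2 • innerSL ℝ x) x := by
  simpa using (hasFDerivAt_id x).norm_sq

/-- The regularized Hardy inequality. -/
theorem hardy_regularized {ε a : ℝ} (hε : 0 < ε) (ha : 0 ≤ a) {φ : E → ℝ} (hφ : ContDiff ℝ 1 φ)
    (hφc : HasCompactSupport φ) :
    a * (N - 2 - a) * ∫ x, φ x ^ 2 / (‖x‖ ^ 2 + ε) ≤ ∫ x, ‖gradient φ x‖ ^ 2 := by
  have hden : ∀ x : E, 0 < ‖x‖ ^ 2 + ε := fun x => by positivity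
  have hnsq : ContDiff ℝ 1 fun x : E => ‖x‖ ^ 2 + ε := (contDiff_norm_sq ℝ).add contDiff_const
  -- The field `x / (‖x‖² + ε)` is smooth at the origin, so its divergence can be integrated by
  -- parts against `φ²`.
  set X : Fin N → E → ℝ := fun i x => x i / (‖x‖ ^ 2 + ε) with hX
  have hXC : ∀ i, ContDiff ℝ 1 (X i) := fun i =>
    (by fun_prop : ContDiff ℝ 1 fun x : E => x i).div hnsq fun x => (hden x).ne'
  have hφ2 : ContDiff ℝ 1 fun x => φ x ^ 2 := hφ.pow 2
  have hφ2c : HasCompactSupport fun x => φ x ^ 2 :=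
    hφc.comp_left (g := fun t : ℝ => t ^ 2) (by simp)
  have hgradc : Continuous (gradient φ) :=
    (InnerProductSpace.toDual ℝ E).symm.continuous.comp (hφ.continuous_fderiv (by norm_num))
  have hgradcs : HasCompactSupport (gradient φ) :=
    (hφc.fderiv ℝ).comp_left (g := (InnerProductSpace.toDual ℝ E).symm) (map_zero _)
  have hinner : ∀ x v, inner ℝ (gradient φ x) v = fderiv ℝ φ x v := by
    intro x v
    simp [gradient]
  set e : Fin N → E := fun i => EuclideanSpace.basisFun (Fin N) ℝ i with he
  have hdX : ∀ i x, fderiv ℝ (X i) x (e i) =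
      1 / (‖x‖ ^ 2 + ε) - 2 * x i ^ 2 / (‖x‖ ^ 2 + ε) ^ 2 := by
    intro i x
    have h1 : HasFDerivAt (fun x : E => x i) (EuclideanSpace.proj i : E →L[ℝ] ℝ) x :=
      (EuclideanSpace.proj i : E →L[ℝ] ℝ).hasFDerivAt
    have h2 := h1.mul ((hasDerivAt_inv (hden x).ne').comp_hasFDerivAt x
      ((hasFDerivAt_norm_sq x).add_const ε))
    have h3 : HasFDerivAt (X i) _ x := h2
    rw [h3.fderiv]
    have := (hden x).ne'
    simp [he, EuclideanSpace.inner_single_right]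
    field_simp
    ring
  have hdiv : ∀ x, ∑ i, fderiv ℝ (X i) x (e i) =
      N / (‖x‖ ^ 2 + ε) - 2 * ‖x‖ ^ 2 / (‖x‖ ^ 2 + ε) ^ 2 := by
    intro x
    simp only [hdX, Finset.sum_sub_distrib, Finset.sum_const, Finset.card_univ, Fintype.card_fin,
      ← Finset.sum_div, ← Finset.mul_sum, EuclideanSpace.real_norm_sq_eq]
    simp [div_eq_mul_inv]
  have hcross : ∀ x, ∑ i, fderiv ℝ (fun x => φ x ^ 2) x (e i) * X i x =
      2 * φ x * inner ℝ (gradient φ x) x / (‖x‖ ^ 2 + ε) := by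
    intro x
    have h1 : ∀ i, fderiv ℝ (fun x => φ x ^ 2) x (e i) = 2 * φ x * fderiv ℝ φ x (e i) := by
      intro i
      rw [((hφ.differentiable (by norm_num) x).hasFDerivAt.pow 2).fderiv]
      simp
    have h2 : x = ∑ i, x i • e i := by
      simpa [he] using ((EuclideanSpace.basisFun (Fin N) ℝ).sum_repr x).symm
    have h3 : fderiv ℝ φ x x = ∑ i, x i * fderiv ℝ φ x (e i) := by
      have h4 := congrArg (fderiv ℝ φ x) h2
      simpa only [map_sum, map_smul, smul_eq_mul] using h4
    rw [hinner, h3]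
    simp only [h1, hX, Finset.mul_sum, Finset.sum_div]
    refine Finset.sum_congr rfl fun i _ => ?_
    ring
  have hint1 : ∀ i, Integrable fun x => fderiv ℝ (fun x => φ x ^ 2) x (e i) * X i x := by
    intro i
    refine Continuous.integrable_of_hasCompactSupport ?_ ?_
    · exact ((hφ2.continuous_fderiv (by norm_num)).clm_apply continuous_const).mul (hXC i).continuous
    · exact (hφ2c.fderiv_apply ℝ (e i)).mul_right
  have hint2 : ∀ i, Integrable fun x => φ x ^ 2 * fderiv ℝ (X i) x (e i) := by
    intro i
    refine Continuous.integrable_of_hasCompactSupport ?_ hφ2c.mul_right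
    exact hφ2.continuous.mul (((hXC i).continuous_fderiv (by norm_num)).clm_apply continuous_const)
  have hibp : ∫ x, 2 * φ x * inner ℝ (gradient φ x) x / (‖x‖ ^ 2 + ε) =
      -∫ x, φ x ^ 2 * (N / (‖x‖ ^ 2 + ε) - 2 * ‖x‖ ^ 2 / (‖x‖ ^ 2 + ε) ^ 2) := by
    simp only [← hcross, ← hdiv, Finset.mul_sum]
    rw [integral_finsetSum _ fun i _ => hint1 i, integral_finsetSum _ fun i _ => hint2 i,
      ← Finset.sum_neg_distrib]
    exact Finset.sum_congr rfl fun i _ => integral_mul_fderiv_apply_eq_neg hφ2 hφ2c (hXC i) (e i)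
  have hI1 : Integrable fun x => ‖gradient φ x‖ ^ 2 := by
    refine Continuous.integrable_of_hasCompactSupport (by fun_prop) ?_
    exact hgradcs.comp_left (g := fun v : E => ‖v‖ ^ 2) (by simp)
  have hI2 : Integrable fun x => 2 * φ x * inner ℝ (gradient φ x) x / (‖x‖ ^ 2 + ε) := by
    simp only [← hcross]
    exact integrable_finsetSum _ fun i _ => hint1 i
  have hI3 : Integrable fun x =>
      φ x ^ 2 * (N / (‖x‖ ^ 2 + ε) - 2 * ‖x‖ ^ 2 / (‖x‖ ^ 2 + ε) ^ 2) := by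
    simp only [← hdiv, Finset.mul_sum]
    exact integrable_finsetSum _ fun i _ => hint2 i
  have hI4 : Integrable fun x => φ x ^ 2 / (‖x‖ ^ 2 + ε) := by
    refine Continuous.integrable_of_hasCompactSupport ?_ ?_
    · exact hφ2.continuous.div hnsq.continuous fun x => (hden x).ne'
    · simp only [div_eq_mul_inv]
      exact hφ2c.mul_right
  have hpt : ∀ x, 0 ≤ (‖gradient φ x‖ ^ 2 +
      a * (2 * φ x * inner ℝ (gradient φ x) x / (‖x‖ ^ 2 + ε))) +
      (a * (φ x ^ 2 * (N / (‖x‖ ^ 2 + ε) - 2 * ‖x‖ ^ 2 / (‖x‖ ^ 2 + ε) ^ 2)) -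
      a * (N - 2 - a) * (φ x ^ 2 / (‖x‖ ^ 2 + ε))) := by
    intro x
    -- Completed square; regularization leaves only the nonnegative remainder `a (2 + a) ε φ² /
    -- (‖x‖² + ε)²`.
    have h1 : 0 ≤ ‖gradient φ x + (a * φ x / (‖x‖ ^ 2 + ε)) • x‖ ^ 2 := by positivity
    rw [norm_add_sq_real, inner_smul_right, norm_smul, mul_pow, Real.norm_eq_abs, sq_abs] at h1
    refine h1.trans ?_
    have hd := hden x
    have e : (‖gradient φ x‖ ^ 2 + a * (2 * φ x * inner ℝ (gradient φ x) x / (‖x‖ ^ 2 + ε))) +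
        (a * (φ x ^ 2 * (N / (‖x‖ ^ 2 + ε) - 2 * ‖x‖ ^ 2 / (‖x‖ ^ 2 + ε) ^ 2)) -
        a * (N - 2 - a) * (φ x ^ 2 / (‖x‖ ^ 2 + ε))) -
        (‖gradient φ x‖ ^ 2 + 2 * (a * φ x / (‖x‖ ^ 2 + ε) * inner ℝ (gradient φ x) x) +
          (a * φ x / (‖x‖ ^ 2 + ε)) ^ 2 * ‖x‖ ^ 2) =
        (a * φ x ^ 2 * (2 + a) * ε) / (‖x‖ ^ 2 + ε) ^ 2 := by
      field_simp
      ring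
    have h2 : 0 ≤ (a * φ x ^ 2 * (2 + a) * ε) / (‖x‖ ^ 2 + ε) ^ 2 := by positivity
    linarith
  have hfin : 0 ≤ ∫ x, ((‖gradient φ x‖ ^ 2 +
      a * (2 * φ x * inner ℝ (gradient φ x) x / (‖x‖ ^ 2 + ε))) +
      (a * (φ x ^ 2 * (N / (‖x‖ ^ 2 + ε) - 2 * ‖x‖ ^ 2 / (‖x‖ ^ 2 + ε) ^ 2)) -
      a * (N - 2 - a) * (φ x ^ 2 / (‖x‖ ^ 2 + ε)))) := integral_nonneg fun x => hpt x
  have hJ1 : Integrable fun x => ‖gradient φ x‖ ^ 2 +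
      a * (2 * φ x * inner ℝ (gradient φ x) x / (‖x‖ ^ 2 + ε)) := hI1.add (hI2.const_mul a)
  have hJ2 : Integrable fun x =>
      a * (φ x ^ 2 * (N / (‖x‖ ^ 2 + ε) - 2 * ‖x‖ ^ 2 / (‖x‖ ^ 2 + ε) ^ 2)) -
      a * (N - 2 - a) * (φ x ^ 2 / (‖x‖ ^ 2 + ε)) := (hI3.const_mul a).sub (hI4.const_mul _)
  rw [integral_add hJ1 hJ2,
    integral_add hI1 (hI2.const_mul a), integral_sub (hI3.const_mul a) (hI4.const_mul _),
    integral_const_mul, integral_const_mul, integral_const_mul, hibp] at hfin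
  linarith

/-- A potential bounded by the Hardy potential has nonnegative quadratic form. -/
theorem integral_nonneg_of_le_hardy (hN : 3 ≤ N) {V : E → ℝ} (hV : Continuous V)
    (hVle : ∀ x, V x * ‖x‖ ^ 2 ≤ ((N - 2) / 2 : ℝ) ^ 2) {φ : E → ℝ}
    (hφ : ContDiff ℝ 1 φ) (hφc : HasCompactSupport φ) :
    0 ≤ ∫ x, (‖gradient φ x‖ ^ 2 - V x * φ x ^ 2) := by
  have hN' : (3 : ℝ) ≤ N := by exact_mod_cast hN
  set κ : ℝ := ((N - 2) / 2 : ℝ) ^ 2 with hκ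
  have hκ0 : 0 < κ := by
    have : 0 < ((N : ℝ) - 2) / 2 := by linarith
    positivity
  have hφ2c : HasCompactSupport fun x => φ x ^ 2 :=
    hφc.comp_left (g := fun t : ℝ => t ^ 2) (by simp)
  have hgradc : Continuous (gradient φ) :=
    (InnerProductSpace.toDual ℝ E).symm.continuous.comp (hφ.continuous_fderiv (by norm_num))
  have hgradcs : HasCompactSupport (gradient φ) :=
    (hφc.fderiv ℝ).comp_left (g := (InnerProductSpace.toDual ℝ E).symm) (map_zero _)
  have hI1 : Integrable fun x => ‖gradient φ x‖ ^ 2 := by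
    refine Continuous.integrable_of_hasCompactSupport (by fun_prop) ?_
    exact hgradcs.comp_left (g := fun v : E => ‖v‖ ^ 2) (by simp)
  have hIV : Integrable fun x => V x * φ x ^ 2 :=
    (hV.mul (hφ.continuous.pow 2)).integrable_of_hasCompactSupport hφ2c.mul_left
  -- Trading `‖x‖²` for `‖x‖² + ε` costs `ε V`, which is controlled on the support of `φ` and
  -- vanishes as `ε → 0`.
  obtain ⟨M, hM⟩ := hφc.isCompact.exists_bound_of_continuousOn hV.continuousOn
  have hbound : ∀ x, V x * φ x ^ 2 ≤ |M| * φ x ^ 2 := by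
    intro x
    by_cases hx : x ∈ tsupport φ
    · exact mul_le_mul_of_nonneg_right
        ((le_abs_self _).trans ((hM x hx).trans (le_abs_self _))) (sq_nonneg _)
    · simp [image_eq_zero_of_notMem_tsupport hx]
  rw [integral_sub hI1 hIV, sub_nonneg]
  set A := ∫ x, ‖gradient φ x‖ ^ 2 with hA
  have hmain : ∀ ε : ℝ, 0 < ε → ∫ x, V x * φ x ^ 2 ≤ (κ + ε * |M|) * (A / κ) := by
    intro ε hε
    -- `a = (N - 2) / 2` maximizes `a (N - 2 - a)`.
    have h1 := hardy_regularized hε (a := ((N : ℝ) - 2) / 2) (by linarith) hφ hφc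
    have e : ((N : ℝ) - 2) / 2 * (N - 2 - (N - 2) / 2) = κ := by rw [hκ]; ring
    rw [e, ← hA, ← le_div_iff₀' hκ0] at h1
    have hI4 : Integrable fun x => φ x ^ 2 / (‖x‖ ^ 2 + ε) := by
      refine Continuous.integrable_of_hasCompactSupport ?_ ?_
      · exact (hφ.continuous.pow 2).div (by fun_prop) fun x => by positivity
      · simp only [div_eq_mul_inv]
        exact hφ2c.mul_right
    have h2 : ∫ x, V x * φ x ^ 2 ≤ ∫ x, (κ + ε * |M|) * (φ x ^ 2 / (‖x‖ ^ 2 + ε)) := by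
      refine integral_mono hIV (hI4.const_mul _) fun x => ?_
      have hd : 0 < ‖x‖ ^ 2 + ε := by positivity
      simp only
      rw [← mul_div_assoc, le_div_iff₀ hd]
      nlinarith [mul_le_mul_of_nonneg_right (hVle x) (sq_nonneg (φ x)),
        mul_le_mul_of_nonneg_left (hbound x) hε.le]
    rw [integral_const_mul] at h2
    exact h2.trans (mul_le_mul_of_nonneg_left h1 (by positivity))
  have hlim : Tendsto (fun ε : ℝ => (κ + ε * |M|) * (A / κ)) (𝓝[>] 0) (𝓝 A) := by
    have : Continuous fun ε : ℝ => (κ + ε * |M|) * (A / κ) := by fun_prop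
    have h2 := this.tendsto 0
    rw [zero_mul, add_zero, mul_div_cancel₀ _ hκ0.ne'] at h2
    exact h2.mono_left nhdsWithin_le_nhds
  refine ge_of_tendsto hlim ?_
  filter_upwards [self_mem_nhdsWithin] with ε hε
  exact hmain ε hε

end Hardy

/-! ### Radial functions on `ℝᴺ`: regularity at the origin and Laplacian -/

section Radial

variable {N : ℕ}

local notation "E" => EuclideanSpace ℝ (Fin N)

theorem hasFDerivAt_norm_of_ne_zero {x : E} (hx : x ≠ 0) :
    HasFDerivAt (fun x : E => ‖x‖) (‖x‖⁻¹ • innerSL ℝ x) x := by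
  have hx0 : ‖x‖ ≠ 0 := norm_ne_zero_iff.2 hx
  have h := (Real.hasDerivAt_sqrt (pow_ne_zero 2 hx0)).comp_hasFDerivAt x (hasFDerivAt_norm_sq x)
  have e : (Real.sqrt ∘ fun x : E => ‖x‖ ^ 2) = fun x : E => ‖x‖ := by
    funext y
    simp [Real.sqrt_sq]
  rw [e] at h
  refine h.congr_fderiv ?_
  ext v
  simp [Real.sqrt_sq]
  field_simp

theorem hasFDerivAt_comp_norm_zero {u : ℝ → ℝ} (hu : HasDerivAt u 0 0) :
    HasFDerivAt (fun x : E => u ‖x‖) (0 : E →L[ℝ] ℝ) 0 := by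
  rw [hasFDerivAt_iff_isLittleO_nhds_zero]
  have h := (hasDerivAt_iff_isLittleO_nhds_zero.1 hu).comp_tendsto
    (show Tendsto (fun x : E => ‖x‖) (𝓝 0) (𝓝 0) by
      simpa using (continuous_id.norm : Continuous fun x : E => ‖x‖).tendsto 0)
  have h2 : (fun x : E => u ‖x‖ - u 0) =o[𝓝 0] fun x : E => ‖x‖ := by
    simpa [Function.comp_def] using h
  simpa using h2.of_norm_right

theorem hasFDerivAt_smul_id_zero {c : E → ℝ} (hc : ContinuousAt c 0) :
    HasFDerivAt (fun x : E => c x • x) (c 0 • ContinuousLinearMap.id ℝ E) 0 := by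
  rw [hasFDerivAt_iff_isLittleO_nhds_zero]
  have h1 : (fun x => c x - c 0) =o[𝓝 (0 : E)] fun _ => (1 : ℝ) := by
    rw [Asymptotics.isLittleO_one_iff]
    simpa using hc.tendsto.sub_const (c 0)
  have h2 := h1.smul_isBigO (Asymptotics.isBigO_refl (fun x : E => x) (𝓝 0))
  simpa [sub_smul] using h2

/-- The derivative of the radial vector field `x ↦ m(‖x‖) x`, where `r m'(r) = b(r)`. -/
noncomputable def radialFieldDeriv (m b : ℝ → ℝ) (x : E) : E →L[ℝ] E :=
  m ‖x‖ • ContinuousLinearMap.id ℝ E + (b ‖x‖ / ‖x‖ ^ 2) • (innerSL ℝ x).smulRight x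

theorem hasFDerivAt_radialField {m b : ℝ → ℝ} (hm : Continuous m)
    (hm' : ∀ r, 0 < r → HasDerivAt m (b r / r) r) (x : E) :
    HasFDerivAt (fun x : E => m ‖x‖ • x) (radialFieldDeriv m b x) x := by
  by_cases hx : x = 0
  · subst hx
    have h := hasFDerivAt_smul_id_zero (N := N) (c := fun x => m ‖x‖)
      (hm.comp continuous_norm).continuousAt
    refine h.congr_fderiv ?_
    simp [radialFieldDeriv]
  · have hx0 : 0 < ‖x‖ := norm_pos_iff.2 hx
    have h := ((hm' _ hx0).comp_hasFDerivAt x (hasFDerivAt_norm_of_ne_zero hx)).smul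
      (hasFDerivAt_id x)
    refine h.congr_fderiv ?_
    ext v i
    simp [radialFieldDeriv]
    field_simp

/-- Only the origin is at issue: the rank-one term there has norm at most `|b ‖x‖|`, which tends to
`b 0 = 0`. -/
theorem continuous_radialFieldDeriv {m b : ℝ → ℝ} (hm : Continuous m) (hb : Continuous b)
    (hb0 : b 0 = 0) : Continuous (radialFieldDeriv (N := N) m b) := by
  refine ((hm.comp continuous_norm).smul continuous_const).add ?_
  rw [continuous_iff_continuousAt]
  intro x
  by_cases hx : x = 0
  · subst hx
    rw [ContinuousAt, norm_zero, hb0, zero_div, zero_smul]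
    refine squeeze_zero_norm (a := fun x : E => |b ‖x‖|) (fun x => ?_) ?_
    · rw [norm_smul, ContinuousLinearMap.norm_smulRight_apply, innerSL_apply_norm, norm_div,
        Real.norm_eq_abs, norm_pow, norm_norm]
      by_cases h : x = 0
      · simp [h]
      · have : ‖x‖ ≠ 0 := norm_ne_zero_iff.2 h
        rw [← pow_two, div_mul_cancel₀ _ (pow_ne_zero 2 this)]
    · have : Continuous fun x : E => |b ‖x‖| := (hb.comp continuous_norm).abs
      simpa [hb0] using this.tendsto 0
  · have hx0 : ‖x‖ ^ 2 ≠ 0 := pow_ne_zero 2 (norm_ne_zero_iff.2 hx)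
    have h1 : Continuous fun x : E => innerSL ℝ x := (innerSL ℝ).continuous
    have h2 : Continuous fun x : E => (innerSL ℝ x).smulRight x := by
      have h3 : Continuous fun p : (E →L[ℝ] ℝ) × E => p.1.smulRight p.2 :=
        ((ContinuousLinearMap.smulRightL ℝ E E).continuous₂)
      exact h3.comp (h1.prodMk continuous_id)
    exact (((hb.comp continuous_norm).continuousAt).div
      (continuous_norm.pow 2).continuousAt hx0).smul h2.continuousAt

theorem contDiff_radialField {m b : ℝ → ℝ} (hm : Continuous m) (hb : Continuous b) (hb0 : b 0 = 0)
    (hm' : ∀ r, 0 < r → HasDerivAt m (b r / r) r) : ContDiff ℝ 1 fun x : E => m ‖x‖ • x := by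
  have h : fderiv ℝ (fun x : E => m ‖x‖ • x) = radialFieldDeriv m b :=
    funext fun x => (hasFDerivAt_radialField hm hm' x).fderiv
  rw [contDiff_one_iff_fderiv, h]
  exact ⟨fun x => (hasFDerivAt_radialField hm hm' x).differentiableAt,
    continuous_radialFieldDeriv hm hb hb0⟩

theorem hasFDerivAt_comp_norm {u m : ℝ → ℝ} (hu : ∀ r, HasDerivAt u (-(r * m r)) r) (x : E) :
    HasFDerivAt (fun x : E => u ‖x‖) (innerSL ℝ (-(m ‖x‖ • x))) x := by
  by_cases hx : x = 0
  · subst hx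
    have h0 := hu 0
    simp only [zero_mul, neg_zero] at h0
    refine (hasFDerivAt_comp_norm_zero h0).congr_fderiv ?_
    simp
  · have hx0 : ‖x‖ ≠ 0 := norm_ne_zero_iff.2 hx
    refine ((hu _).comp_hasFDerivAt x (hasFDerivAt_norm_of_ne_zero hx)).congr_fderiv ?_
    ext v
    simp
    field_simp

theorem fderiv_comp_norm_apply {u m : ℝ → ℝ} (hu : ∀ r, HasDerivAt u (-(r * m r)) r) (x v : E) :
    fderiv ℝ (fun x : E => u ‖x‖) x v = -inner ℝ (m ‖x‖ • x) v := by
  rw [(hasFDerivAt_comp_norm hu x).fderiv, innerSL_apply_apply, inner_neg_left]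

/-- Regularity of `x ↦ u(‖x‖)` when `u' = -r m` and `r m' = b` with `b(0) = 0`. -/
theorem contDiff_two_comp_norm {u m b : ℝ → ℝ} (hu : ∀ r, HasDerivAt u (-(r * m r)) r)
    (hm : Continuous m) (hb : Continuous b) (hb0 : b 0 = 0)
    (hm' : ∀ r, 0 < r → HasDerivAt m (b r / r) r) : ContDiff ℝ 2 fun x : E => u ‖x‖ := by
  refine contDiff_succ_iff_fderiv (n := 1) |>.2 ⟨fun x => (hasFDerivAt_comp_norm hu x).differentiableAt, by simp, ?_⟩
  rw [contDiff_clm_apply_iff]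
  intro v
  simp only [fderiv_comp_norm_apply hu]
  exact ((contDiff_radialField hm hb hb0 hm').inner ℝ contDiff_const).neg

/-- The gradient is `-m(‖x‖) x`, so the Laplacian is minus the trace of `radialFieldDeriv`. -/
theorem laplacian_comp_norm {u m b : ℝ → ℝ} (hu : ∀ r, HasDerivAt u (-(r * m r)) r)
    (hm : Continuous m) (hb : Continuous b) (hb0 : b 0 = 0)
    (hm' : ∀ r, 0 < r → HasDerivAt m (b r / r) r) (x : E) :
    Δ (fun x : E => u ‖x‖) x = -(N * m ‖x‖ + b ‖x‖) := by
  have hC := contDiff_two_comp_norm (N := N) hu hm hb hb0 hm'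
  have hC1 : ContDiff ℝ 1 (fderiv ℝ fun x : E => u ‖x‖) := hC.fderiv_right (by norm_num)
  have h1 : ∀ v : E, fderiv ℝ (fderiv ℝ fun x : E => u ‖x‖) x v v =
      -inner ℝ (radialFieldDeriv m b x v) v := by
    intro v
    have h2 := ((hC1.differentiable (by norm_num) x).hasFDerivAt.clm_apply
      (hasFDerivAt_const v x))
    have h3 : HasFDerivAt (fun y => fderiv ℝ (fun x : E => u ‖x‖) y v) _ x :=
      ((hasFDerivAt_radialField hm hm' x).inner ℝ (hasFDerivAt_const v x)).neg.congr_of_eventuallyEq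
        (Eventually.of_forall fun y => fderiv_comp_norm_apply hu y v)
    have h4 := DFunLike.congr_fun (h2.unique h3) v
    simpa using h4
  rw [InnerProductSpace.laplacian_eq_iteratedFDeriv_orthonormalBasis _
    (EuclideanSpace.basisFun (Fin N) ℝ)]
  simp only [iteratedFDeriv_two_apply, Matrix.cons_val_zero, Matrix.cons_val_one, h1]
  simp only [radialFieldDeriv, Finset.sum_neg_distrib]
  have h5 : ∀ i : Fin N, inner ℝ ((m ‖x‖ • ContinuousLinearMap.id ℝ E +
      (b ‖x‖ / ‖x‖ ^ 2) • (innerSL ℝ x).smulRight x) (EuclideanSpace.basisFun (Fin N) ℝ i))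
      (EuclideanSpace.basisFun (Fin N) ℝ i) = m ‖x‖ + b ‖x‖ / ‖x‖ ^ 2 * x i ^ 2 := by
    intro i
    simp [inner_add_left, inner_smul_left, EuclideanSpace.inner_single_right]
    left
    ring
  simp only [h5, Finset.sum_add_distrib, ← Finset.mul_sum, ← EuclideanSpace.real_norm_sq_eq]
  by_cases hx : x = 0
  · simp [hx, hb0]
  · have : ‖x‖ ^ 2 ≠ 0 := pow_ne_zero 2 (norm_ne_zero_iff.2 hx)
    rw [div_mul_cancel₀ _ this]
    simp

end Radial

/-! ### Uniqueness for the radial problem -/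

theorem IsAdmissible.exists_lipschitz_bound {f : ℝ → ℝ} (hf : IsAdmissible f) (M : ℝ) :
    ∃ L : ℝ, 0 ≤ L ∧ ∀ a ∈ Icc (-M) M, ∀ b ∈ Icc (-M) M, |f a - f b| ≤ L * |a - b| := by
  obtain ⟨L, hL⟩ := (isCompact_Icc (a := -M) (b := M)).exists_bound_of_continuousOn
    hf.continuous_deriv.continuousOn
  refine ⟨|L|, abs_nonneg L, fun a ha b hb => ?_⟩
  exact (convex_Icc (-M) M).norm_image_sub_le_of_norm_deriv_le
    (fun x _ => (hf.hasDerivAt x).differentiableAt) (fun x hx => (hL x hx).trans (le_abs_self L)) hb ha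

namespace IsRadialSolution

variable {N : ℕ} {f : ℝ → ℝ} {α : ℝ} {u v : ℝ → ℝ}

theorem hasDerivAt (hu : IsRadialSolution N f α u) {r : ℝ} (hr : 0 < r) :
    HasDerivAt u (deriv u r) r :=
  ((hu.contDiffOn_two.differentiableOn (by norm_num)).differentiableAt
    (Ioi_mem_nhds hr)).hasDerivAt

theorem hasDerivAt_deriv (hu : IsRadialSolution N f α u) {r : ℝ} (hr : 0 < r) :
    HasDerivAt (deriv u) (deriv (deriv u) r) r := by
  have h : ContDiffOn ℝ 1 (deriv u) (Ioi 0) :=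
    ((contDiffOn_succ_iff_deriv_of_isOpen (n := 1) isOpen_Ioi).1
      (by rw [one_add_one_eq_two]; exact hu.contDiffOn_two)).2.2
  exact ((h.differentiableOn (by norm_num)).differentiableAt (Ioi_mem_nhds hr)).hasDerivAt

theorem tendsto (hu : IsRadialSolution N f α u) : Tendsto u (𝓝[>] 0) (𝓝 α) := by
  have h := hu.contDiffOn_one.continuousOn 0 self_mem_Ici
  rw [ContinuousWithinAt, hu.init] at h
  exact h.mono_left (nhdsWithin_mono _ Ioi_subset_Ici_self)

theorem tendsto_deriv (hu : IsRadialSolution N f α u) : Tendsto (deriv u) (𝓝[>] 0) (𝓝 0) := by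
  have h := (hu.contDiffOn_one.continuousOn_derivWithin (uniqueDiffOn_Ici 0) le_rfl) 0 self_mem_Ici
  rw [ContinuousWithinAt, hu.deriv_init] at h
  refine (h.mono_left (nhdsWithin_mono _ Ioi_subset_Ici_self)).congr' ?_
  filter_upwards [self_mem_nhdsWithin] with r hr
  exact derivWithin_of_mem_nhds (Ici_mem_nhds hr)

/-- Grönwall for the energy `z'² + z²` of the difference. The singular term `(N - 1) / r z'` is
damping and has the favourable sign, so only the Lipschitz constant on the common range enters. -/
theorem eqOn (hf : IsAdmissible f) (hN : 1 ≤ N) (hu : IsRadialSolution N f α u)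
    (hv : IsRadialSolution N f α v) {r : ℝ} (hr : 0 ≤ r) : v r = u r := by
  rcases hr.eq_or_lt with rfl | hr
  · rw [hu.init, hv.init]
  have hN' : (1 : ℝ) ≤ N := by exact_mod_cast hN
  obtain ⟨A, hA⟩ := (isCompact_Icc (a := 0) (b := r + 1)).exists_bound_of_continuousOn
    (hu.contDiffOn_one.continuousOn.mono fun x hx => hx.1)
  obtain ⟨B, hB⟩ := (isCompact_Icc (a := 0) (b := r + 1)).exists_bound_of_continuousOn
    (hv.contDiffOn_one.continuousOn.mono fun x hx => hx.1)
  obtain ⟨L, hL0, hL⟩ := hf.exists_lipschitz_bound (max A B)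
  have hlip : ∀ x ∈ Ioo 0 (r + 1), |f (u x) - f (v x)| ≤ L * |u x - v x| := by
    intro x hx
    refine hL _ (abs_le.1 ?_) _ (abs_le.1 ?_)
    · exact (hA x ⟨hx.1.le, hx.2.le⟩).trans (le_max_left _ _)
    · exact (hB x ⟨hx.1.le, hx.2.le⟩).trans (le_max_right _ _)
  set z : ℝ → ℝ := fun x => u x - v x with hz
  set z₁ : ℝ → ℝ := fun x => deriv u x - deriv v x with hz₁
  have hzl : Tendsto z (𝓝[>] 0) (𝓝 0) := by simpa using hu.tendsto.sub hv.tendsto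
  have hz₁l : Tendsto z₁ (𝓝[>] 0) (𝓝 0) := by simpa using hu.tendsto_deriv.sub hv.tendsto_deriv
  have hzd : ∀ x, 0 < x → HasDerivAt z (z₁ x) x := fun x hx =>
    (hu.hasDerivAt hx).sub (hv.hasDerivAt hx)
  have hz₁d : ∀ x, 0 < x → HasDerivAt z₁ (-((N - 1) / x * z₁ x) - (f (u x) - f (v x))) x := by
    intro x hx
    refine ((hu.hasDerivAt_deriv hx).sub (hv.hasDerivAt_deriv hx)).congr_deriv ?_
    have h1 := hu.ode x hx
    have h2 := hv.ode x hx
    simp only [hz₁]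
    linarith
  have hE := nonneg_of_hasDerivAt_nonneg_of_tendsto (R := r + 1)
    (g := fun x => -(Real.exp (-((L + 1) * x)) * (z₁ x ^ 2 + z x ^ 2)))
    (fun x hx => (((((hasDerivAt_id x).const_mul (L + 1)).neg.exp).mul
      (((hz₁d x hx.1).pow 2).add ((hzd x hx.1).pow 2))).neg)) ?_ ?_
    (r := r) ⟨hr, by linarith⟩
  · have h1 : z₁ r ^ 2 + z r ^ 2 ≤ 0 := by
      have := Real.exp_pos (-((L + 1) * r))
      by_contra! h
      have := mul_pos this h
      linarith
    have h2 : z r = 0 := by nlinarith [sq_nonneg (z₁ r), sq_nonneg (z r)]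
    simp only [hz] at h2
    linarith
  · intro x hx
    have hx0 : 0 < x := hx.1
    have hl := hlip x hx
    have hd : 0 ≤ ((N : ℝ) - 1) / x * z₁ x ^ 2 :=
      mul_nonneg (div_nonneg (by linarith) hx0.le) (sq_nonneg _)
    have h1 : -(z₁ x * (f (u x) - f (v x))) ≤ L * (|z₁ x| * |z x|) := by
      refine (neg_le_abs _).trans ?_
      rw [abs_mul]
      have := mul_le_mul_of_nonneg_left hl (abs_nonneg (z₁ x))
      simp only [hz]
      linarith
    have h2 : z x * z₁ x ≤ |z₁ x| * |z x| := by
      rw [← abs_mul, mul_comm]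
      exact le_abs_self _
    have h3 : 2 * (|z₁ x| * |z x|) ≤ z₁ x ^ 2 + z x ^ 2 := by
      nlinarith [sq_nonneg (|z₁ x| - |z x|), sq_abs (z₁ x), sq_abs (z x)]
    have h4 : 0 ≤ (L + 1) * (z₁ x ^ 2 + z x ^ 2 - 2 * (|z₁ x| * |z x|)) :=
      mul_nonneg (by linarith) (by linarith)
    have h5 : 0 ≤ (L + 1) * (z₁ x ^ 2 + z x ^ 2) -
        (2 * z₁ x * (-((N - 1) / x * z₁ x) - (f (u x) - f (v x))) + 2 * z x * z₁ x) := by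
      nlinarith
    have h6 := mul_nonneg (Real.exp_pos (-((L + 1) * x))).le h5
    refine h6.trans_eq ?_
    simp
    ring
  · have h1 : Tendsto (fun x : ℝ => Real.exp (-((L + 1) * x))) (𝓝[>] 0) (𝓝 1) := by
      have : Continuous fun x : ℝ => Real.exp (-((L + 1) * x)) := by fun_prop
      have h2 := this.tendsto 0
      simp only [mul_zero, neg_zero, Real.exp_zero] at h2
      exact h2.mono_left nhdsWithin_le_nhds
    simpa using (h1.mul ((hz₁l.pow 2).add (hzl.pow 2))).neg

end IsRadialSolution

/-! ### Consequences of the Hardy bound: global positivity, stability, ordering -/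

/-- A positive radial solution `u` with `u' = -r m`, for which `f'(u)` is bounded by the Hardy
potential. -/
structure IsHardyBoundedSolution (N : ℕ) (f : ℝ → ℝ) (α : ℝ) (u m : ℝ → ℝ) : Prop where
  init : u 0 = α
  continuous_slope : Continuous m
  hasDerivAt : ∀ r, HasDerivAt u (-(r * m r)) r
  hasDerivAt_slope : ∀ r, 0 < r → HasDerivAt m ((f (u r) - N * m r) / r) r
  slope_zero : f α - N * m 0 = 0
  pos : ∀ r, 0 ≤ r → 0 < u r
  hardy : ∀ r, 0 < r → deriv f (u r) * r ^ 2 ≤ (((N : ℝ) - 2) / 2) ^ 2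

section

variable {N : ℕ} {f : ℝ → ℝ} {q₁ q₂ α : ℝ}

theorem hasDerivAt_neg_mul_slope {m : ℝ → ℝ} {F : ℝ} {r : ℝ} (hr : 0 < r)
    (hm : HasDerivAt m ((F - N * m r) / r) r) :
    HasDerivAt (fun r => -(r * m r)) (-F - (N - 1) / r * -(r * m r)) r := by
  refine (((hasDerivAt_id r).mul hm).neg).congr_deriv ?_
  simp only [id]
  field_simp
  ring

/-- The Hardy bound on `f'(u)` along any classical solution, as long as it stays positive. -/
theorem IsAdmissible.deriv_mul_sq_le (hf : IsAdmissible f) (hN : 11 ≤ N) (h₁ : 1 ≤ q₁)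
    (hN₁₂ : q₂ * (2 * (N : ℝ) - 4 * q₁) ≤ ((N : ℝ) - 2) ^ 2 / 4) (hqJ : q₁ ≤ qJL N)
    (hq : ∀ u : ℝ, 0 < u → q₁ ≤ deriv f u * tailIntegral f u ∧ deriv f u * tailIntegral f u ≤ q₂)
    {R : ℝ} (hα : 0 < α) {u u₁ u₂ : ℝ → ℝ} (hu : ∀ r ∈ Ioo 0 R, HasDerivAt u (u₁ r) r)
    (hu₁ : ∀ r ∈ Ioo 0 R, HasDerivAt u₁ (u₂ r) r)
    (hode : ∀ r ∈ Ioo 0 R, u₂ r + ((N : ℝ) - 1) / r * u₁ r + f (u r) = 0)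
    (hl : Tendsto u (𝓝[>] 0) (𝓝 α)) (hl₁ : Tendsto u₁ (𝓝[>] 0) (𝓝 0))
    (hpos : ∀ r ∈ Ioo 0 R, 0 < u r) {r : ℝ} (hr : r ∈ Ioo 0 R) :
    deriv f (u r) * r ^ 2 ≤ (((N : ℝ) - 2) / 2) ^ 2 := by
  obtain ⟨l₁, l₂, hl₁0, hl₂0, -, hprod⟩ := exists_pos_roots_of_le_qJL hN hqJ
  have hb : 0 < 2 * (N : ℝ) - 4 * q₁ := hprod ▸ mul_pos hl₁0 hl₂0
  have h := hf.sq_le_mul_tailIntegral hN h₁ hqJ (fun u hu => (hq u hu).1) hα hu hu₁ hode hl hl₁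
    hpos hr
  have h1 := mul_le_mul_of_nonneg_left h (hf.deriv_pos _ (hpos r hr)).le
  have h2 := mul_le_mul_of_nonneg_left (hq _ (hpos r hr)).2 hb.le
  nlinarith

theorem tendsto_nhdsGT_of_continuous {g : ℝ → ℝ} (hg : Continuous g) :
    Tendsto g (𝓝[>] 0) (𝓝 (g 0)) := (hg.tendsto 0).mono_left nhdsWithin_le_nhds

/-- The truncated problem has a global solution, nonincreasing on `[0, ∞)` and hence at most `α`
there. While it stays positive it solves the original equation and obeys the Hardy bound, which in
turn prevents a first zero. -/
theorem IsAdmissible.exists_hardyBoundedSolution (hf : IsAdmissible f) (hN : 11 ≤ N)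
    (h₁ : 1 ≤ q₁) (hN₁₂ : q₂ * (2 * (N : ℝ) - 4 * q₁) ≤ ((N : ℝ) - 2) ^ 2 / 4)
    (hqJ : q₁ ≤ qJL N)
    (hq : ∀ u : ℝ, 0 < u → q₁ ≤ deriv f u * tailIntegral f u ∧ deriv f u * tailIntegral f u ≤ q₂)
    (hα : 0 < α) : ∃ u m : ℝ → ℝ, IsHardyBoundedSolution N f α u m := by
  set h : ℝ → ℝ := fun x => f (projIcc 0 α hα.le x) with hh
  have hproj : ∀ x, (projIcc 0 α hα.le x : ℝ) ∈ Icc 0 α := fun x => (projIcc 0 α hα.le x).2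
  obtain ⟨L, hL0, hL⟩ := hf.exists_lipschitz_bound α
  have hK : LipschitzWith ⟨L, hL0⟩ h := by
    refine LipschitzWith.of_dist_le_mul fun x y => ?_
    have h1 := hL _ ⟨by linarith [(hproj x).1], (hproj x).2⟩ _
      ⟨by linarith [(hproj y).1], (hproj y).2⟩
    have h2 := (LipschitzWith.projIcc hα.le).dist_le_mul x y
    rw [Subtype.dist_eq, Real.dist_eq, NNReal.coe_one, one_mul] at h2
    exact h1.trans (mul_le_mul_of_nonneg_left h2 hL0)
  obtain ⟨M, hM⟩ := (isCompact_Icc (a := 0) (b := α)).exists_bound_of_continuousOn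
    hf.continuous.continuousOn
  have hfnn : ∀ x, 0 ≤ x → 0 ≤ f x := by
    intro x hx
    rcases hx.eq_or_lt with rfl | hx
    · rw [hf.map_zero]
    · exact (hf.pos x hx).le
  have hh0 : ∀ x, 0 ≤ h x := fun x => hfnn _ (hproj x).1
  obtain ⟨n, rfl⟩ : ∃ n, N = n + 1 := ⟨N - 1, by omega⟩
  obtain ⟨u, m, hu0, hmc, hu, hm, hmeq⟩ :=
    exists_radial_solution_of_lipschitz n hK (M := M) (fun x => hM _ (hproj x)) α
  have hm0 : ∀ r, 0 ≤ m r := fun r => hmeq ▸ radialMean_nonneg n (fun x => hh0 _) r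
  have huc : Continuous u := continuous_iff_continuousAt.2 fun r => (hu r).continuousAt
  have hanti : AntitoneOn u (Ici 0) := by
    refine antitoneOn_of_deriv_nonpos (convex_Ici 0) huc.continuousOn
      (fun x _ => (hu x).differentiableAt.differentiableWithinAt) fun x hx => ?_
    rw [interior_Ici] at hx
    rw [(hu x).deriv, neg_nonpos]
    exact mul_nonneg (le_of_lt hx) (hm0 x)
  have hle : ∀ r, 0 ≤ r → u r ≤ α := fun r hr => hu0 ▸ hanti self_mem_Ici hr hr
  have hhf : ∀ r, 0 ≤ r → 0 ≤ u r → h (u r) = f (u r) := by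
    intro r hr hur
    simp only [hh, projIcc_of_mem hα.le (⟨hur, hle r hr⟩ : u r ∈ Icc 0 α)]
  set u₁ : ℝ → ℝ := fun r => -(r * m r) with hu₁
  set u₂ : ℝ → ℝ := fun r => -h (u r) - (((n + 1 : ℕ) : ℝ) - 1) / r * u₁ r with hu₂
  have hu₁c : Continuous u₁ := by fun_prop
  have hl : Tendsto u (𝓝[>] 0) (𝓝 α) := hu0 ▸ tendsto_nhdsGT_of_continuous huc
  have hl₁ : Tendsto u₁ (𝓝[>] 0) (𝓝 0) := by
    have := tendsto_nhdsGT_of_continuous hu₁c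
    simpa [hu₁] using this
  have hu₁d : ∀ r, 0 < r → HasDerivAt u₁ (u₂ r) r := fun r hr =>
    hasDerivAt_neg_mul_slope hr (by push_cast; exact hm r hr)
  have hN' : (11 : ℝ) ≤ ((n + 1 : ℕ) : ℝ) := by exact_mod_cast hN
  have hbound : ∀ R, 0 < R → (∀ r ∈ Ico 0 R, 0 < u r) → ∀ r ∈ Ioo 0 R,
      deriv f (u r) * r ^ 2 ≤ ((((n + 1 : ℕ) : ℝ) - 2) / 2) ^ 2 := by
    intro R _ hpos r hr
    refine hf.deriv_mul_sq_le hN h₁ hN₁₂ hqJ hq hα (fun r _ => hu r) (fun r hr => hu₁d r hr.1)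
      (fun r hr => ?_) hl hl₁ (fun r hr => hpos r ⟨hr.1.le, hr.2⟩) hr
    simp only [hu₂, hhf r hr.1.le (hpos r ⟨hr.1.le, hr.2⟩).le]
    ring
  have hpos : ∀ r, 0 ≤ r → 0 < u r := by
    intro r hr
    refine pos_of_forall_pos_on_Ico huc.continuousOn (hu0.symm ▸ hα) (fun R hR hpos => ?_) hr
    refine pos_of_hardy_subsolution (γ := (((n + 1 : ℕ) : ℝ) - 2) / 2) (by linarith) hR
      (fun r _ => hu r) (fun r hr => hu₁d r hr.1) (fun r hr => ?_) hl hl₁ huc.continuousAt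
      fun r hr => hpos r ⟨hr.1.le, hr.2⟩
    have hur := hpos r ⟨hr.1.le, hr.2⟩
    have hr2 : 0 < r ^ 2 := pow_pos hr.1 2
    -- `f(u) ≤ f'(u) u ≤ γ² / r² u` with `γ = (N - 2) / 2`: the solution is its own Hardy
    -- subsolution.
    have h2 := hf.sub_le_deriv_mul le_rfl hur
    rw [hf.map_zero, sub_zero, sub_zero] at h2
    have h3 := (le_div_iff₀ hr2).2 (hbound R hR hpos r hr)
    have h4 := mul_le_mul_of_nonneg_right h3 hur.le
    simp only [hu₂, hhf r hr.1.le hur.le]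
    have e : 2 * ((((n + 1 : ℕ) : ℝ) - 2) / 2) + 1 = ((n + 1 : ℕ) : ℝ) - 1 := by ring
    rw [e]
    linarith
  refine ⟨u, m, hu0, hmc, hu, fun r hr => ?_, ?_, hpos, fun r hr => ?_⟩
  · rw [← hhf r hr.le (hpos r hr.le).le]
    push_cast
    exact hm r hr
  · have h2 : m 0 = f α / (n + 1) := by
      rw [hmeq, radialMean_zero, hhf 0 le_rfl (hpos 0 le_rfl).le, hu0]
    rw [h2]
    push_cast
    field_simp
    ring
  · exact hbound (r + 1) (by linarith) (fun x hx => hpos x hx.1) r ⟨hr, by linarith⟩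

namespace IsHardyBoundedSolution

variable {u m : ℝ → ℝ}

theorem continuous (hu : IsHardyBoundedSolution N f α u m) : Continuous u :=
  continuous_iff_continuousAt.2 fun r => (hu.hasDerivAt r).continuousAt

theorem deriv_eq (hu : IsHardyBoundedSolution N f α u m) : deriv u = fun r => -(r * m r) :=
  funext fun r => (hu.hasDerivAt r).deriv

theorem hasDerivAt_deriv (hu : IsHardyBoundedSolution N f α u m) {r : ℝ} (hr : 0 < r) :
    HasDerivAt (fun r => -(r * m r)) (-f (u r) - (N - 1) / r * -(r * m r)) r :=
  hasDerivAt_neg_mul_slope hr (hu.hasDerivAt_slope r hr)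

theorem isRadialSolution (hf : IsAdmissible f) (hu : IsHardyBoundedSolution N f α u m) :
    IsRadialSolution N f α u where
  contDiffOn_one := by
    refine (contDiff_one_iff_deriv.2 ⟨fun r => (hu.hasDerivAt r).differentiableAt, ?_⟩).contDiffOn
    rw [hu.deriv_eq]
    have := hu.continuous_slope
    fun_prop
  contDiffOn_two := by
    refine (contDiffOn_succ_iff_deriv_of_isOpen (n := 1) isOpen_Ioi).2
      ⟨fun r _ => (hu.hasDerivAt r).differentiableAt.differentiableWithinAt, by simp, ?_⟩
    rw [hu.deriv_eq]
    refine (contDiffOn_succ_iff_deriv_of_isOpen (n := 0) isOpen_Ioi).2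
      ⟨fun r hr => (hu.hasDerivAt_deriv hr).differentiableAt.differentiableWithinAt, by simp, ?_⟩
    rw [contDiffOn_zero]
    refine ContinuousOn.congr (f := fun r => -f (u r) - (N - 1) / r * -(r * m r)) ?_
      fun r hr => (hu.hasDerivAt_deriv hr).deriv
    have h1 := hu.continuous_slope
    have h2 := hf.continuous.comp hu.continuous
    refine h2.neg.continuousOn.sub ((continuousOn_const.div continuousOn_id fun r hr => ?_).mul
      (by fun_prop : Continuous fun r => -(r * m r)).continuousOn)
    exact ne_of_gt hr
  ode r hr := by
    rw [hu.deriv_eq, (hu.hasDerivAt_deriv hr).deriv]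
    ring
  init := hu.init
  deriv_init := by
    rw [(hu.hasDerivAt 0).hasDerivWithinAt.derivWithin (uniqueDiffOn_Ici 0 0 self_mem_Ici)]
    simp

theorem isStableSolution (hf : IsAdmissible f) (hN : 3 ≤ N)
    (hu : IsHardyBoundedSolution N f α u m) : IsStableSolution N f fun x => u ‖x‖ := by
  have hb : Continuous fun r => f (u r) - N * m r :=
    (hf.continuous.comp hu.continuous).sub (continuous_const.mul hu.continuous_slope)
  have hb0 : f (u 0) - N * m 0 = 0 := by rw [hu.init, hu.slope_zero]
  refine ⟨contDiff_two_comp_norm hu.hasDerivAt hu.continuous_slope hb hb0 hu.hasDerivAt_slope,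
    fun x => ?_, fun φ hφ hφc => ?_⟩
  · rw [laplacian_comp_norm hu.hasDerivAt hu.continuous_slope hb hb0 hu.hasDerivAt_slope]
    ring
  · refine integral_nonneg_of_le_hardy hN
      (hf.continuous_deriv.comp (hu.continuous.comp continuous_norm)) (fun x => ?_) hφ hφc
    rcases (norm_nonneg x).eq_or_lt with hx | hx
    · rw [← hx]
      simp only [ne_eq, OfNat.ofNat_ne_zero, not_false_eq_true, zero_pow, mul_zero]
      positivity
    · exact hu.hardy _ hx

/-- While `v > u`, convexity gives `f(v) - f(u) ≤ f'(v) (v - u)`, so the Hardy bound along the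
larger solution makes `v - u` a Hardy subsolution, which cannot vanish for the first time. -/
theorem lt_of_init_lt (hf : IsAdmissible f) (hN : 3 ≤ N) {β : ℝ} {v k : ℝ → ℝ}
    (hu : IsHardyBoundedSolution N f α u m) (hv : IsHardyBoundedSolution N f β v k)
    (hαβ : α < β) {r : ℝ} (hr : 0 ≤ r) : u r < v r := by
  have hN' : (3 : ℝ) ≤ N := by exact_mod_cast hN
  have hzc : Continuous fun r => v r - u r := hv.continuous.sub hu.continuous
  have hz₁c : Continuous fun r => -(r * k r) - -(r * m r) := by
    have := hv.continuous_slope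
    have := hu.continuous_slope
    fun_prop
  refine sub_pos.1 (pos_of_forall_pos_on_Ico hzc.continuousOn ?_ (fun R hR hpos => ?_) hr)
  · rw [hu.init, hv.init]
    linarith
  refine pos_of_hardy_subsolution (γ := ((N : ℝ) - 2) / 2) (z := fun r => v r - u r)
    (by linarith) hR
    (fun r _ => (hv.hasDerivAt r).sub (hu.hasDerivAt r))
    (fun r hr => (hv.hasDerivAt_deriv hr.1).sub (hu.hasDerivAt_deriv hr.1))
    (fun r hr => ?_) (tendsto_nhdsGT_of_continuous hzc) (tendsto_nhdsGT_of_continuous hz₁c)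
    hzc.continuousAt fun r hr => hpos r ⟨hr.1.le, hr.2⟩
  have hz := hpos r ⟨hr.1.le, hr.2⟩
  have h2 := hf.sub_le_deriv_mul (hu.pos r hr.1.le).le (sub_pos.1 hz)
  have h3 := (le_div_iff₀ (pow_pos hr.1 2)).2 (hv.hardy r hr.1)
  have h4 := mul_le_mul_of_nonneg_right h3 hz.le
  have e : 2 * (((N : ℝ) - 2) / 2) + 1 = (N : ℝ) - 1 := by ring
  rw [e]
  linarith

end IsHardyBoundedSolution

theorem structureII_of_forall_exists (hf : IsAdmissible f) (hN : 3 ≤ N)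
    (hex : ∀ α : ℝ, 0 < α → ∃ u m : ℝ → ℝ, IsHardyBoundedSolution N f α u m) :
    StructureII N f := by
  choose! u m hum using hex
  refine ⟨fun r α => u α r, fun α hα => ⟨(hum α hα).isRadialSolution hf, fun v hv r hr => ?_⟩,
    fun α hα => (hum α hα).isStableSolution hf hN, fun r hr α hα β hβ hαβ => ?_⟩
  · exact ((hum α hα).isRadialSolution hf).eqOn hf (by omega) hv hr
  · exact (hum α hα).lt_of_init_lt hf hN (hum β hβ) hαβ hr.le

end

theorem corollary1p4 (N : ℕ) (hN : 11 ≤ N) (f : ℝ → ℝ) (hf : IsAdmissible f)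
    (q₁ q₂ : ℝ) (h₁ : 1 ≤ q₁) (h₁₂ : q₁ ≤ q₂)
    (hN₁₂ : q₂ * (2 * (N : ℝ) - 4 * q₁) ≤ ((N : ℝ) - 2) ^ 2 / 4)
    (hq : ∀ u : ℝ, 0 < u →
      q₁ ≤ deriv f u ^ 2 / (f u * deriv (deriv f) u) ∧
        deriv f u ^ 2 / (f u * deriv (deriv f) u) ≤ q₂) :
    (∀ u : ℝ, 0 < u →
      q₁ ≤ deriv f u * tailIntegral f u ∧ deriv f u * tailIntegral f u ≤ q₂) ∧
    (q₁ ≤ qJL N → StructureII N f) := by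
  have hF : ∀ u : ℝ, 0 < u →
      q₁ ≤ deriv f u * tailIntegral f u ∧ deriv f u * tailIntegral f u ≤ q₂ := fun u hu =>
    ⟨hf.le_deriv_mul_tailIntegral (fun u hu => (hq u hu).1) hu,
      hf.deriv_mul_tailIntegral_le (fun u hu => (hq u hu).2) hu⟩
  exact ⟨hF, fun hqJ => structureII_of_forall_exists hf (by omega) fun α hα =>
    hf.exists_hardyBoundedSolution hN h₁ hN₁₂ hqJ hF hα⟩
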